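/- Let $f:\mathbb{R}^n\to\mathbb{R}$ be real-analytic near the origin, i.e. $f(x)=\sum_{\alpha\in\mathbb{N}^n}a_\alpha x^\alpha$ (its Taylor series) for all $x$ in a neighbourhood of $0$, with $f(0)=0$ and $\nabla f(0)=0$. Let $$\mathcal N_f=\text{convex hull of }\bigcup_{a_\alpha\neq0}(\alpha+\mathbb{R}_+^n),\qquad d_f=\inf\{t:(t,\dots,t)\in\mathcal N_f\}$$ be the Newton polyhedron and the Newton distance of $f$, where $\mathbb{R}_+=[0,\infty)$. Assume that $f$ is $\mathbb{R}$-nondegenerate: for every (nonempty) compact face $\gamma$ of $\mathcal N_f$, the gradient of $f_\gamma(x)=\sum_{\alpha\in\gamma}a_\alpha x^\alpha$ vanishes nowhere on $(\mathbb{R}\setminus\{0\})^n$. Assume that some compact face of $\mathcal N_f$ contains the point $(d_f,\dots,d_f)$; the compact face of minimal dimension that contains it is called the principal face, and $k$ denotes its codimension in $\mathbb{R}^n$ (so $k\ge1$). Then there is $r>0$ such that for every smooth function $\varphi:\mathbb{R}^n\to\mathbb{C}$ supported in the ball $\{|x|<r\}$ there is a constant $C_\varphi$ such that, for all $\lambda\ge2$,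 the integral $I(\lambda)=\int_{\mathbb{R}^n}e^{i\lambda f(x)}\varphi(x)\,dx$ satisfies $$|I(\lambda)|\le C_\varphi\,\lambda^{-1/d_f}(\ln\lambda)^{k-1}\quad\text{if }1/d_f\text{ is not an integer},$$ $$|I(\lambda)|\le C_\varphi\,\lambda^{-1/d_f}(\ln\lambda)^{k}\quad\text{if }1/d_f\text{ is an integer}.$$ -/

import Mathlib

namespace OscNewton

noncomputable section

/-- The partial derivative `∂g/∂xᵢ` of a function on `ℝⁿ`. -/
def partialDeriv {n : ℕ} (i : Fin n) (g : EuclideanSpace ℝ (Fin n) → ℝ) :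
    EuclideanSpace ℝ (Fin n) → ℝ :=
  fun x => lineDeriv ℝ g x (EuclideanSpace.single i (1 : ℝ))

/-- The mixed partial derivative `∂^α f = ∂₁^{α₁} ⋯ ∂ₙ^{αₙ} f` for a multi-index `α`. -/
def mixedDeriv {n : ℕ} (α : Fin n → ℕ) (f : EuclideanSpace ℝ (Fin n) → ℝ) :
    EuclideanSpace ℝ (Fin n) → ℝ :=
  (List.finRange n).foldr (fun i g => (partialDeriv i)^[α i] g) f

/-- The Taylor coefficient `a_α = ∂^α f(0) / α!` of `f` at the origin. -/
def taylorCoeff {n : ℕ} (f : EuclideanSpace ℝ (Fin n) → ℝ) (α : Fin n → ℕ) : ℝ :=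
  mixedDeriv α f 0 / ((∏ i, (α i).factorial : ℕ) : ℝ)

/-- The monomial `x^α = x₁^{α₁} ⋯ xₙ^{αₙ}`. -/
def monomial {n : ℕ} (α : Fin n → ℕ) (x : EuclideanSpace ℝ (Fin n)) : ℝ :=
  ∏ i, x i ^ α i

/-- `f` is real-analytic near the origin: in some neighbourhood of `0` its Taylor series
`∑ a_α x^α` converges (unconditionally) to `f`. -/
def RealAnalyticNearZero {n : ℕ} (f : EuclideanSpace ℝ (Fin n) → ℝ) : Prop :=
  ∀ᶠ x in nhds (0 : EuclideanSpace ℝ (Fin n)),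
    HasSum (fun α : Fin n → ℕ => taylorCoeff f α * monomial α x) (f x)

/-- A multi-index, viewed as a point of the real space of exponents. -/
def exponentPoint {n : ℕ} (α : Fin n → ℕ) : Fin n → ℝ :=
  fun i => (α i : ℝ)

/-- The Newton polyhedron of `f`: the convex hull of the union of the orthants `α + ℝ₊ⁿ`
over all `α` with `a_α ≠ 0`. The set `Set.Ici (exponentPoint α)` (for the coordinatewise order)
is the orthant `α + ℝ₊ⁿ`. -/
def newtonPolyhedron {n : ℕ} (f : EuclideanSpace ℝ (Fin n) → ℝ) : Set (Fin n → ℝ) :=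
  convexHull ℝ (⋃ α ∈ {α : Fin n → ℕ | taylorCoeff f α ≠ 0}, Set.Ici (exponentPoint α))

/-- The Newton distance `d_f = inf {t : (t, …, t) ∈ 𝒩_f}`. -/
def newtonDistance {n : ℕ} (f : EuclideanSpace ℝ (Fin n) → ℝ) : ℝ :=
  sInf {t : ℝ | (fun _ : Fin n => t) ∈ newtonPolyhedron f}

/-- `γ` is a compact face of the Newton polyhedron of `f`: a nonempty compact set cut out of the
polyhedron by a supporting hyperplane (the set where some linear functional attains its maximum
over the polyhedron). -/
def IsCompactFace {n : ℕ} (f : EuclideanSpace ℝ (Fin n) → ℝ) (γ : Set (Fin n → ℝ)) : Prop :=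
  γ.Nonempty ∧ IsExposed ℝ (newtonPolyhedron f) γ ∧ IsCompact γ

/-- The dimension of a face, i.e. of its affine span. -/
def faceDim {n : ℕ} (γ : Set (Fin n → ℝ)) : ℕ :=
  Module.finrank ℝ (vectorSpan ℝ γ)

/-- `γ` is the principal face of `f`: the compact face containing `(d_f, …, d_f)` that has
minimal dimension among the compact faces containing this point. -/
def IsPrincipalFace {n : ℕ} (f : EuclideanSpace ℝ (Fin n) → ℝ) (γ : Set (Fin n → ℝ)) : Prop :=
  IsCompactFace f γ ∧ (fun _ : Fin n => newtonDistance f) ∈ γ ∧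
    ∀ γ' : Set (Fin n → ℝ), IsCompactFace f γ' → (fun _ : Fin n => newtonDistance f) ∈ γ' →
      faceDim γ ≤ faceDim γ'

/-- The `γ`-part `f_γ(x) = ∑_{α ∈ γ} a_α x^α` of `f`; the sum is finite when `γ` is compact. -/
def facePart {n : ℕ} (f : EuclideanSpace ℝ (Fin n) → ℝ) (γ : Set (Fin n → ℝ)) :
    EuclideanSpace ℝ (Fin n) → ℝ :=
  fun x => ∑ᶠ α ∈ {α : Fin n → ℕ | exponentPoint α ∈ γ}, taylorCoeff f α * monomial α x

/-- `f` is `ℝ`-nondegenerate: for every compact face `γ` of its Newton polyhedron, the gradient of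
`f_γ` vanishes nowhere on `(ℝ ∖ {0})ⁿ`. -/
def IsNondegenerate {n : ℕ} (f : EuclideanSpace ℝ (Fin n) → ℝ) : Prop :=
  ∀ γ : Set (Fin n → ℝ), IsCompactFace f γ →
    ∀ x : EuclideanSpace ℝ (Fin n), (∀ i, x i ≠ 0) → gradient (facePart f γ) x ≠ 0

/-- The oscillatory integral `I(t) = ∫ e^{i t f(x)} φ(x) dx` over `ℝⁿ`. -/
def oscIntegral {n : ℕ} (f : EuclideanSpace ℝ (Fin n) → ℝ) (φ : EuclideanSpace ℝ (Fin n) → ℂ)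
    (t : ℝ) : ℂ :=
  ∫ x : EuclideanSpace ℝ (Fin n), Complex.exp (Complex.I * (t : ℂ) * (f x : ℂ)) * φ x

end

end OscNewton

namespace OscNewton

open Set Filter Topology MeasureTheory
open scoped ContDiff Matrix Pointwise

lemma exists_nat_mul_pow_le {r ρ : ℝ} (hr : 0 < r) (hrρ : r < ρ) :
    ∃ C : ℝ, 0 ≤ C ∧ ∀ m : ℕ, (m : ℝ) * r ^ (m - 1) ≤ C * ρ ^ m := by
  have hρ : 0 < ρ := hr.trans hrρ
  have h1 : ‖r / ρ‖ < 1 := by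
    rw [Real.norm_of_nonneg (by positivity)]; exact (div_lt_one hρ).2 hrρ
  have hs := summable_pow_mul_geometric_of_norm_lt_one 1 h1
  obtain ⟨B, hB⟩ := hs.tendsto_atTop_zero.bddAbove_range
  have hB' : ∀ m : ℕ, (m : ℝ) ^ 1 * (r / ρ) ^ m ≤ B := fun m => hB ⟨m, rfl⟩
  have hB0 : 0 ≤ B := by simpa using hB' 0
  refine ⟨B / r, by positivity, fun m => ?_⟩
  rcases Nat.eq_zero_or_pos m with rfl | hm
  · simp; positivity
  have := hB' m
  rw [pow_one, div_pow, ← mul_div_assoc, div_le_iff₀ (by positivity)] at this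
  obtain ⟨k, rfl⟩ : ∃ k, m = k + 1 := ⟨m - 1, by omega⟩
  rw [Nat.add_sub_cancel, div_mul_eq_mul_div, le_div_iff₀ hr]
  calc _ = ((k + 1 : ℕ) : ℝ) * r ^ (k + 1) := by ring
    _ ≤ _ := this

lemma summable_deriv_coeff {n : ℕ} {ι : Type*} (c : ι → ℝ) (e : ι → Fin n → ℕ) {r ρ : ℝ}
    (hr : 0 < r) (hrρ : r < ρ) (h : Summable fun k => |c k| * ρ ^ (∑ i, e k i)) (i : Fin n) :
    Summable fun k => |c k * e k i| * r ^ (∑ j, Function.update (e k) i (e k i - 1) j) := by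
  obtain ⟨C, hC0, hC⟩ := exists_nat_mul_pow_le hr hrρ
  have hρ : 0 < ρ := hr.trans hrρ
  refine Summable.of_nonneg_of_le (fun k => by positivity) (fun k => ?_) (h.mul_left C)
  rcases Nat.eq_zero_or_pos (e k i) with h0 | h0
  · simp [h0]; positivity
  have hsum : ∑ j, Function.update (e k) i (e k i - 1) j = ∑ j, e k j - 1 := by
    rw [← Finset.add_sum_erase _ _ (Finset.mem_univ i),
      ← Finset.add_sum_erase (Finset.univ) (e k) (Finset.mem_univ i)]
    have : ∑ x ∈ Finset.univ.erase i, Function.update (e k) i (e k i - 1) x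
        = ∑ x ∈ Finset.univ.erase i, e k x := by
      refine Finset.sum_congr rfl fun x hx => ?_
      simp [Finset.ne_of_mem_erase hx]
    rw [this]; simp; omega
  rw [hsum, abs_mul, Nat.abs_cast]
  have hle : (e k i : ℝ) ≤ ((∑ j, e k j : ℕ) : ℝ) := by
    exact_mod_cast Finset.single_le_sum (f := e k) (fun _ _ => Nat.zero_le _) (Finset.mem_univ i)
  calc |c k| * (e k i : ℝ) * r ^ (∑ j, e k j - 1)
      ≤ |c k| * (((∑ j, e k j : ℕ) : ℝ) * r ^ (∑ j, e k j - 1)) := by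
        rw [mul_assoc]; gcongr
    _ ≤ |c k| * (C * ρ ^ (∑ j, e k j)) := mul_le_mul_of_nonneg_left (hC _) (abs_nonneg _)
    _ = _ := by ring

lemma abs_monomial_le {n : ℕ} (e : Fin n → ℕ) {x : Fin n → ℝ} {r : ℝ}
    (hx : ∀ i, |x i| ≤ r) : |∏ i, x i ^ e i| ≤ r ^ (∑ i, e i) := by
  rw [Finset.abs_prod, ← Finset.prod_pow_eq_pow_sum]
  refine Finset.prod_le_prod (fun i _ => abs_nonneg _) fun i _ => ?_
  rw [abs_pow]; exact pow_le_pow_left₀ (abs_nonneg _) (hx i) _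

lemma hasFDerivAt_monomial {n : ℕ} (e : Fin n → ℕ) (x : Fin n → ℝ) :
    HasFDerivAt (fun x : Fin n → ℝ => ∏ i, x i ^ e i)
      (∑ i, ((e i : ℝ) * ∏ j, x j ^ Function.update e i (e i - 1) j) •
        (ContinuousLinearMap.proj i : (Fin n → ℝ) →L[ℝ] ℝ)) x := by
  have h := HasFDerivAt.finsetProd (u := Finset.univ) (x := x)
    (g := fun i (x : Fin n → ℝ) => x i ^ e i)
    (g' := fun i => ((e i : ℝ) * x i ^ (e i - 1)) •
        (ContinuousLinearMap.proj i : (Fin n → ℝ) →L[ℝ] ℝ)) (fun i _ => by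
      have := (ContinuousLinearMap.proj (R := ℝ) (φ := fun _ : Fin n => ℝ) i).hasFDerivAt (x := x)
      simpa using this.pow (e i))
  refine h.congr_fderiv (Finset.sum_congr rfl fun i _ => ?_)
  rw [smul_smul]
  congr 1
  rw [← Finset.mul_prod_erase _ _ (Finset.mem_univ i)]
  have : ∏ j ∈ Finset.univ.erase i, x j ^ Function.update e i (e i - 1) j
      = ∏ j ∈ Finset.univ.erase i, x j ^ e j := by
    refine Finset.prod_congr rfl fun j hj => ?_
    simp [Finset.ne_of_mem_erase hj]
  rw [this]; simp; ring

lemma summable_powerSeries {n : ℕ} {ι : Type*} {c : ι → ℝ} {e : ι → Fin n → ℕ} {ρ : ℝ}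
    (h : Summable fun k => |c k| * ρ ^ (∑ i, e k i)) {x : Fin n → ℝ} (hx : ∀ i, |x i| ≤ ρ) :
    Summable fun k => c k * ∏ i, x i ^ e k i := by
  refine Summable.of_norm_bounded h fun k => ?_
  rw [Real.norm_eq_abs, abs_mul]
  gcongr; exact abs_monomial_le _ hx

lemma hasFDerivAt_powerSeries {n : ℕ} {ι : Type*} {c : ι → ℝ} {e : ι → Fin n → ℕ} {ρ : ℝ}
    (h : Summable fun k => |c k| * ρ ^ (∑ i, e k i)) {x : Fin n → ℝ} (hx : x ∈ Metric.ball 0 ρ) :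
    HasFDerivAt (fun x : Fin n → ℝ => ∑' k, c k * ∏ i, x i ^ e k i)
      (∑ i, (∑' k, c k * e k i * ∏ j, x j ^ Function.update (e k) i (e k i - 1) j) •
        (ContinuousLinearMap.proj i : (Fin n → ℝ) →L[ℝ] ℝ)) x := by
  have hρ : 0 < ρ := Metric.pos_of_mem_ball hx
  obtain ⟨r, hxr, hrρ⟩ := exists_between (mem_ball_zero_iff.1 hx)
  have hr : 0 < r := (norm_nonneg _).trans_lt hxr
  have hmem : ∀ {y : Fin n → ℝ}, y ∈ Metric.ball (0 : Fin n → ℝ) r → ∀ i, |y i| ≤ r :=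
    fun hy i => (norm_le_pi_norm _ i).trans (mem_ball_zero_iff.1 hy).le
  have hsum := fun i => summable_deriv_coeff c e hr hrρ h i
  have hd : ∀ k, ∀ y ∈ Metric.ball (0 : Fin n → ℝ) r,
      HasFDerivAt (fun x : Fin n → ℝ => c k * ∏ i, x i ^ e k i)
        (∑ i, (c k * e k i * ∏ j, y j ^ Function.update (e k) i (e k i - 1) j) •
        (ContinuousLinearMap.proj i : (Fin n → ℝ) →L[ℝ] ℝ)) y := fun k y _ => by
    refine ((hasFDerivAt_monomial (e k) y).const_mul (c k)).congr_fderiv ?_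
    rw [Finset.smul_sum]
    refine Finset.sum_congr rfl fun i _ => ?_
    rw [smul_smul, mul_assoc]
  have key := hasFDerivAt_tsum_of_isPreconnected (x₀ := x) (x := x)
    (u := fun k => ∑ i, |c k * e k i| * r ^ (∑ j, Function.update (e k) i (e k i - 1) j))
    (summable_sum fun i _ => hsum i) Metric.isOpen_ball
    (convex_ball (0 : Fin n → ℝ) r).isPreconnected hd
    (fun k y hy => by
      refine (norm_sum_le _ _).trans (Finset.sum_le_sum fun i _ => ?_)
      rw [norm_smul, Real.norm_eq_abs, abs_mul]
      have h1 : ‖(ContinuousLinearMap.proj i : (Fin n → ℝ) →L[ℝ] ℝ)‖ ≤ 1 :=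
        ContinuousLinearMap.opNorm_le_bound _ zero_le_one fun z => by
          simpa using norm_le_pi_norm z i
      refine (mul_le_of_le_one_right (by positivity) h1).trans ?_
      gcongr
      exact abs_monomial_le _ (hmem hy))
    (mem_ball_zero_iff.2 hxr) (summable_powerSeries h fun i =>
      (norm_le_pi_norm _ i).trans (mem_ball_zero_iff.1 hx).le) (mem_ball_zero_iff.2 hxr)
  refine key.congr_fderiv ?_
  have hs : ∀ i, Summable fun k => c k * e k i * ∏ j, x j ^ Function.update (e k) i (e k i - 1) j :=
    fun i => summable_powerSeries (hsum i) (hmem (mem_ball_zero_iff.2 hxr))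
  rw [Summable.tsum_finsetSum fun i _ => (hs i).smul_const _]
  exact Finset.sum_congr rfl fun i _ => (hs i).tsum_smul_const _

/-- An absolutely convergent power series in several variables is smooth. -/
lemma contDiffOn_powerSeries {n : ℕ} {ι : Type*} {c : ι → ℝ} {e : ι → Fin n → ℕ} {ρ : ℝ}
    (h : Summable fun k => |c k| * ρ ^ (∑ i, e k i)) :
    ContDiffOn ℝ ∞ (fun x : Fin n → ℝ => ∑' k, c k * ∏ i, x i ^ e k i) (Metric.ball 0 ρ) := by
  rw [contDiffOn_infty]
  intro m
  induction m generalizing c e ρ with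
  | zero =>
    exact contDiffOn_zero.2 fun x hx =>
      (hasFDerivAt_powerSeries h hx).continuousAt.continuousWithinAt
  | succ m ih =>
    push_cast
    rw [contDiffOn_succ_iff_fderiv_of_isOpen Metric.isOpen_ball]
    refine ⟨fun x hx => (hasFDerivAt_powerSeries h hx).differentiableAt.differentiableWithinAt,
      fun h => by simp at h, ?_⟩
    refine ContDiffOn.congr ?_ fun x hx => (hasFDerivAt_powerSeries h hx).fderiv
    refine ContDiffOn.sum fun i _ => ContDiffOn.fun_smul ?_ contDiffOn_const
    intro x hx
    obtain ⟨r, hxr, hrρ⟩ := exists_between (mem_ball_zero_iff.1 hx)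
    have hr : 0 < r := (norm_nonneg _).trans_lt hxr
    exact ((ih (summable_deriv_coeff c e hr hrρ h i)).contDiffAt
      (Metric.isOpen_ball.mem_nhds (mem_ball_zero_iff.2 hxr))).contDiffWithinAt

/-- Every smooth function on a ball about the origin agrees near the origin with a globally smooth
function. -/
lemma exists_contDiff_extension {n : ℕ} {g : (Fin n → ℝ) → ℝ} {ρ : ℝ} (hρ : 0 < ρ)
    (hg : ContDiffOn ℝ ∞ g (Metric.ball 0 ρ)) :
    ∃ G : (Fin n → ℝ) → ℝ, ContDiff ℝ ∞ G ∧ ∀ x ∈ Metric.ball 0 (ρ / 4), G x = g x := by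
  let b : ContDiffBump (0 : Fin n → ℝ) := ⟨ρ / 4, ρ / 2, by positivity, by linarith⟩
  refine ⟨fun x => b x * g x, contDiff_iff_contDiffAt.2 fun x => ?_, fun x hx => ?_⟩
  · by_cases hx : x ∈ Metric.ball (0 : Fin n → ℝ) ρ
    · exact b.contDiff.contDiffAt.mul (hg.contDiffAt (Metric.isOpen_ball.mem_nhds hx))
    · have hx' : x ∉ tsupport b := by
        rw [b.tsupport_eq]
        simp only [Metric.mem_ball, not_lt, Metric.mem_closedBall, not_le, b] at hx ⊢
        linarith
      refine (contDiffAt_const (c := (0 : ℝ))).congr_of_eventuallyEq ?_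
      filter_upwards [(isClosed_tsupport b).isOpen_compl.mem_nhds hx'] with y hy
      simp [image_eq_zero_of_notMem_tsupport hy]
  · simp only [b.one_of_mem_closedBall (Metric.ball_subset_closedBall hx), one_mul]

lemma finite_setOf_minimal {n : ℕ} (P : (Fin n → ℕ) → Prop) : {α | Minimal P α}.Finite := by
  have hpwo := Set.isPWO_of_wellQuasiOrderedLE {α | P α}
  exact (setOfPred_minimal_antichain _).finite_of_partiallyWellOrderedOn
    (hpwo.mono (setOfPred_minimal_subset _))

/-- A convergent power series is, near the origin, a finite sum of monomials with smooth
coefficients, the monomials being the minimal ones of the series. -/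
lemma exists_monomial_decomposition {n : ℕ} (a : (Fin n → ℕ) → ℝ) (F : (Fin n → ℝ) → ℝ)
    (hF : ∀ᶠ x in 𝓝 0, HasSum (fun α => a α * ∏ i, x i ^ α i) (F x)) (S : Finset (Fin n → ℕ))
    (hS : ∀ s, s ∈ S ↔ Minimal (fun α => a α ≠ 0) s) :
    ∃ G : (Fin n → ℕ) → (Fin n → ℝ) → ℝ,
      (∀ s, ContDiff ℝ ∞ (G s)) ∧ (∀ s ∈ S, G s 0 = a s) ∧
      ∀ᶠ x in 𝓝 0, F x = ∑ s ∈ S, (∏ i, x i ^ s i) * G s x := by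
  classical
  have hex : ∀ α, ∃ s, a α ≠ 0 → s ∈ S ∧ s ≤ α := fun α => by
    by_cases h : a α ≠ 0
    · obtain ⟨s, hs, hm⟩ := exists_minimal_le_of_wellFoundedLT (fun α => a α ≠ 0) α h
      exact ⟨s, fun _ => ⟨(hS s).2 hm, hs⟩⟩
    · exact ⟨0, fun h' => absurd h' h⟩
  choose π hπ using hex
  obtain ⟨ρ₀, hρ₀, hball⟩ := Metric.eventually_nhds_iff.1 hF
  set ρ := ρ₀ / 2 with hρdef
  have hρ : 0 < ρ := by positivity
  have habs : Summable fun α : Fin n → ℕ => |a α| * ρ ^ (∑ i, α i) := by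
    have := (hball (y := fun _ => ρ) (by
      rw [dist_zero_right]
      refine (pi_norm_const_le ρ).trans_lt ?_
      rw [Real.norm_of_nonneg hρ.le, hρdef]; linarith)).summable.abs
    refine this.congr fun α => ?_
    rw [abs_mul, Finset.prod_pow_eq_pow_sum, abs_of_pos (pow_pos hρ _)]
  let c : (Fin n → ℕ) → (Fin n → ℕ) → ℝ := fun s α => if a α ≠ 0 ∧ π α = s then a α else 0
  have hc : ∀ s, Summable fun α => |c s α| * ρ ^ (∑ i, (α - s) i) := fun s => by
    refine Summable.of_nonneg_of_le (fun α => by positivity) (fun α => ?_)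
      (habs.mul_right ((ρ ^ ∑ i, s i)⁻¹))
    by_cases h : a α ≠ 0 ∧ π α = s
    · have hle : s ≤ α := h.2 ▸ (hπ α h.1).2
      have hsum : ∑ i, α i = ∑ i, (α - s) i + ∑ i, s i := by
        rw [← Finset.sum_add_distrib]
        exact Finset.sum_congr rfl fun i _ => by simp [Nat.sub_add_cancel (hle i)]
      rw [hsum, pow_add]
      simp only [c, if_pos h]
      rw [← mul_assoc, mul_inv_cancel_right₀ (by positivity)]
    · simp only [c, if_neg h, abs_zero, zero_mul]; positivity
  choose G hG hGeq using fun s => exists_contDiff_extension hρ (contDiffOn_powerSeries (hc s))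
  refine ⟨G, hG, fun s hs => ?_, ?_⟩
  · rw [hGeq s 0 (Metric.mem_ball_self (by positivity)), tsum_eq_single s]
    · have hmin := (hS s).1 hs
      have h1 := hπ s hmin.1
      have : π s = s := le_antisymm h1.2 (hmin.2 ((hS _).1 h1.1).1 h1.2)
      have h2 : a s ≠ 0 := hmin.1
      simp [c, h2, this]
    · intro α hα
      by_cases h : a α ≠ 0 ∧ π α = s
      · have hle : s ≤ α := h.2 ▸ (hπ α h.1).2
        obtain ⟨i, hi⟩ : ∃ i, s i < α i := by
          by_contra! hcon
          exact hα (le_antisymm hcon hle)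
        rw [Finset.prod_eq_zero (Finset.mem_univ i), mul_zero]
        simp; omega
      · simp only [c, if_neg h, zero_mul]
  · filter_upwards [Metric.ball_mem_nhds (0 : Fin n → ℝ) (by positivity : 0 < ρ / 4)] with x hx
    have hxρ : dist x 0 < ρ / 4 := hx
    have hxs : ∀ i, |x i| ≤ ρ := fun i => (norm_le_pi_norm x i).trans (by
      rw [dist_zero_right] at hxρ; linarith)
    have h1 := hball (y := x) (by linarith)
    rw [← h1.tsum_eq]
    have h2 : ∀ α, a α * ∏ i, x i ^ α i
        = ∑ s ∈ S, (∏ i, x i ^ s i) * (c s α * ∏ i, x i ^ (α - s) i) := fun α => by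
      by_cases h : a α ≠ 0
      · rw [Finset.sum_eq_single (π α)]
        · have hle := (hπ α h).2
          simp only [c]
          rw [if_pos ⟨h, trivial⟩, mul_left_comm, ← Finset.prod_mul_distrib]
          congr 1
          refine Finset.prod_congr rfl fun i _ => ?_
          rw [← pow_add, Pi.sub_apply, Nat.add_sub_cancel' (hle i)]
        · intro s _ hs
          simp only [c]
          rw [if_neg fun h' => hs h'.2.symm]; simp
        · exact fun h' => absurd (hπ α h).1 h'
      · simp [c, h]
        simp only [not_not] at h
        simp [h]
    simp_rw [h2]
    rw [Summable.tsum_finsetSum fun s _ => (summable_powerSeries (hc s) hxs).mul_left _]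
    refine Finset.sum_congr rfl fun s _ => ?_
    rw [tsum_mul_left, hGeq s x hx]

lemma integral_fderiv_apply_eq_zero {n : ℕ} {g : (Fin n → ℝ) → ℂ} (hg : ContDiff ℝ 1 g)
    (hs : HasCompactSupport g) (v : Fin n → ℝ) : ∫ x, fderiv ℝ g x v = 0 := by
  have hi : Integrable (fun x => fderiv ℝ g x v) :=
    ((hg.continuous_fderiv one_ne_zero).clm_apply continuous_const).integrable_of_hasCompactSupport
      (hs.fderiv_apply ℝ v)
  have h := integral_mul_fderiv_eq_neg_fderiv_mul_of_integrable (μ := volume) (𝕜 := ℂ)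
    (f := fun _ : Fin n → ℝ => (1 : ℂ)) (g := g) (v := v) (by simp) (by simpa using hi)
    (by simpa using hg.continuous.integrable_of_hasCompactSupport hs)
    (fun x _ => by fun_prop) (fun x _ => hg.differentiable one_ne_zero x)
  simpa using h

lemma exists_contDiff_inv {δ : ℝ} (hδ : 0 < δ) :
    ∃ ψ : ℝ → ℝ, ContDiff ℝ ∞ ψ ∧ ∀ u, δ ≤ u → ψ u * u = 1 := by
  refine ⟨fun u => Real.smoothTransition (2 * u / δ - 1) / u, ?_, fun u hu => ?_⟩
  · refine contDiff_iff_contDiffAt.2 fun u => ?_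
    by_cases hu : u = 0
    · refine (contDiffAt_const (c := (0 : ℝ))).congr_of_eventuallyEq ?_
      have : Iio (δ / 2) ∈ 𝓝 u := Iio_mem_nhds (by rw [hu]; positivity)
      filter_upwards [this] with y hy
      rw [Real.smoothTransition.zero_of_nonpos, zero_div]
      have : 2 * y / δ ≤ 1 := (div_le_one hδ).2 (by have := mem_Iio.1 hy; linarith)
      linarith
    · exact ContDiffAt.div (Real.smoothTransition.contDiff.comp (by fun_prop)).contDiffAt
        contDiffAt_id hu
  · have hu' : u ≠ 0 := (hδ.trans_le hu).ne'
    change Real.smoothTransition (2 * u / δ - 1) / u * u = 1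
    rw [Real.smoothTransition.one_of_one_le, one_div, inv_mul_cancel₀ hu']
    have : 2 ≤ 2 * u / δ := by rw [le_div_iff₀ hδ]; linarith
    linarith

section Parameters

variable {n : ℕ} {P F : Type*} [NormedAddCommGroup P] [NormedSpace ℝ P] [NormedAddCommGroup F]
  [NormedSpace ℝ F]

lemma hasFDerivAt_section {H : (Fin n → ℝ) × P → F} (hH : ContDiff ℝ ∞ H) (p : P) (y : Fin n → ℝ) :
    HasFDerivAt (fun y => H (y, p)) ((fderiv ℝ H (y, p)).comp
      (ContinuousLinearMap.inl ℝ (Fin n → ℝ) P)) y :=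
  ((hH.differentiable (by simp)) (y, p)).hasFDerivAt.comp y (hasFDerivAt_prodMk_left y p)

lemma contDiff_partial {H : (Fin n → ℝ) × P → F} (hH : ContDiff ℝ ∞ H) (i : Fin n) :
    ContDiff ℝ ∞ fun z => fderiv ℝ H z (Pi.single i 1, 0) :=
  (hH.fderiv_right (m := ∞) (by simp)).clm_apply contDiff_const

/-- One integration by parts in an oscillatory integral with parameters. -/
lemma exists_integration_by_parts {Φ : (Fin n → ℝ) × P → ℝ} (hΦ : ContDiff ℝ ∞ Φ)
    {K : Set (Fin n → ℝ)} (hK : IsCompact K) {Q : Set P} (hQ : IsCompact Q)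
    (hgrad : ∀ y ∈ K, ∀ p ∈ Q, fderiv ℝ (fun y => Φ (y, p)) y ≠ 0)
    {a : (Fin n → ℝ) × P → ℂ} (ha : ContDiff ℝ ∞ a) (hsupp : ∀ y ∉ K, ∀ p, a (y, p) = 0) :
    ∃ a' : (Fin n → ℝ) × P → ℂ, ContDiff ℝ ∞ a' ∧ (∀ y ∉ K, ∀ p, a' (y, p) = 0) ∧
      ∀ p ∈ Q, ∀ t : ℝ, 0 < t →
        ‖∫ y, Complex.exp (Complex.I * t * Φ (y, p)) * a (y, p)‖ =
          t⁻¹ * ‖∫ y, Complex.exp (Complex.I * t * Φ (y, p)) * a' (y, p)‖ := by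
  let D : Fin n → (Fin n → ℝ) × P → ℝ := fun i z => fderiv ℝ Φ z (Pi.single i 1, 0)
  have hD : ∀ i, ContDiff ℝ ∞ (D i) := contDiff_partial hΦ
  let u : (Fin n → ℝ) × P → ℝ := fun z => ∑ i, D i z ^ 2
  have hu : ContDiff ℝ ∞ u := ContDiff.sum fun i _ => (hD i).pow 2
  have hupos : ∀ z ∈ K ×ˢ Q, 0 < u z := by
    rintro ⟨y, p⟩ ⟨hy, hp⟩
    by_contra! hcon
    have h0 : ∀ i, D i (y, p) = 0 := fun i => by
      have h1 : u (y, p) = 0 := le_antisymm hcon (Finset.sum_nonneg fun i _ => sq_nonneg _)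
      have := (Finset.sum_eq_zero_iff_of_nonneg fun i _ => sq_nonneg (D i (y, p))).1 h1 i
        (Finset.mem_univ i)
      exact pow_eq_zero_iff two_ne_zero |>.1 this
    refine hgrad y hy p hp ?_
    rw [(hasFDerivAt_section hΦ p y).fderiv]
    refine ContinuousLinearMap.coe_injective (LinearMap.pi_ext' fun i => LinearMap.ext_ring ?_)
    simpa using h0 i
  obtain ⟨δ, hδ, hδu⟩ : ∃ δ > 0, ∀ z ∈ K ×ˢ Q, δ ≤ u z := by
    rcases (K ×ˢ Q).eq_empty_or_nonempty with h | h
    · exact ⟨1, one_pos, by simp [h]⟩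
    · obtain ⟨z, hz, hmin⟩ := (hK.prod hQ).exists_isMinOn h hu.continuous.continuousOn
      exact ⟨u z, hupos z hz, fun w hw => hmin hw⟩
  obtain ⟨ψ, hψ, hψu⟩ := exists_contDiff_inv hδ
  let b : Fin n → (Fin n → ℝ) × P → ℂ := fun i z => ((ψ (u z) * D i z : ℝ) : ℂ) * a z
  have hb : ∀ i, ContDiff ℝ ∞ (b i) := fun i =>
    (Complex.ofRealCLM.contDiff.comp ((hψ.comp hu).mul (hD i))).mul ha
  have hbs : ∀ i, ∀ y ∉ K, ∀ p, b i (y, p) = 0 := fun i y hy p => by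
    simp only [b, hsupp y hy p, mul_zero]
  have hfd0 : ∀ i, ∀ y ∉ K, ∀ p, fderiv ℝ (b i) (y, p) (Pi.single i 1, 0) = 0 := by
    intro i y hy p
    have h1 := hasFDerivAt_section (hb i) p y
    have h2 : HasFDerivAt (fun y => b i (y, p)) (0 : (Fin n → ℝ) →L[ℝ] ℂ) y := by
      refine (hasFDerivAt_const (0 : ℂ) y).congr_of_eventuallyEq ?_
      filter_upwards [hK.isClosed.isOpen_compl.mem_nhds hy] with w hw
      exact hbs i w hw p
    have := DFunLike.congr_fun (h1.unique h2) (Pi.single i 1)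
    simpa using this
  refine ⟨fun z => ∑ i, fderiv ℝ (b i) z (Pi.single i 1, 0),
    ContDiff.sum fun i _ => contDiff_partial (hb i) i,
    fun y hy p => Finset.sum_eq_zero fun i _ => hfd0 i y hy p, fun p hp t ht => ?_⟩
  let e : (Fin n → ℝ) → ℂ := fun y => Complex.exp (Complex.I * t * Φ (y, p))
  have he : ContDiff ℝ ∞ e := by
    have : ContDiff ℝ ∞ fun y => Φ (y, p) := hΦ.comp (contDiff_id.prodMk contDiff_const)
    exact (contDiff_const.mul (Complex.ofRealCLM.contDiff.comp this)).cexp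
  have hsec : ∀ i, ContDiff ℝ ∞ fun y => b i (y, p) := fun i =>
    (hb i).comp (contDiff_id.prodMk contDiff_const)
  have hcs : ∀ {g : (Fin n → ℝ) → ℂ}, (∀ y ∉ K, g y = 0) → HasCompactSupport g := fun h =>
    HasCompactSupport.intro hK h
  have hder : ∀ i y, fderiv ℝ (fun y => e y * b i (y, p)) y (Pi.single i 1)
      = e y * fderiv ℝ (b i) (y, p) (Pi.single i 1, 0)
        + Complex.I * t * (e y * (((D i (y, p) : ℝ) : ℂ) * b i (y, p))) := by
    intro i y
    have h1 : HasFDerivAt e (e y • ((Complex.I * t) • (Complex.ofRealCLM.comp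
        ((fderiv ℝ Φ (y, p)).comp (ContinuousLinearMap.inl ℝ (Fin n → ℝ) P))))) y :=
      ((Complex.ofRealCLM.hasFDerivAt.comp y (hasFDerivAt_section hΦ p y)).const_mul _).cexp
    rw [(h1.fun_mul (hasFDerivAt_section (hb i) p y)).fderiv]
    simp [D]
    ring
  have hsum : ∀ y, ∑ i, ((D i (y, p) : ℝ) : ℂ) * b i (y, p) = a (y, p) := by
    intro y
    by_cases hy : y ∈ K
    · have h1 := hψu _ (hδu (y, p) ⟨hy, hp⟩)
      have h2 : ∑ i, D i (y, p) * (ψ (u (y, p)) * D i (y, p)) = 1 := by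
        rw [← h1, Finset.mul_sum]
        exact Finset.sum_congr rfl fun i _ => by ring
      simp only [b, ← mul_assoc, ← Finset.sum_mul]
      simp only [← Complex.ofReal_mul, ← Complex.ofReal_sum]
      simp only [h2, Complex.ofReal_one, one_mul]
    · simp [hbs _ y hy, hsupp y hy]
  have hint : ∀ i, Integrable fun y => e y * fderiv ℝ (b i) (y, p) (Pi.single i 1, 0) := fun i =>
    (he.continuous.mul ((contDiff_partial (hb i) i).continuous.comp
      (by fun_prop : Continuous fun y => (y, p)))).integrable_of_hasCompactSupport
      (hcs fun y hy => by simp [hfd0 i y hy p])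
  have hint' : ∀ i, Integrable fun y => Complex.I * t * (e y * (((D i (y, p) : ℝ) : ℂ) * b i (y, p))) :=
    fun i => by
      refine Continuous.integrable_of_hasCompactSupport ?_ (hcs fun y hy => by simp [hbs i y hy p])
      refine continuous_const.mul (he.continuous.mul (Continuous.mul ?_ (hsec i).continuous))
      exact Complex.continuous_ofReal.comp ((hD i).continuous.comp (by fun_prop))
  have hzero : ∑ i, ∫ y, fderiv ℝ (fun y => e y * b i (y, p)) y (Pi.single i 1) = 0 :=
    Finset.sum_eq_zero fun i _ => integral_fderiv_apply_eq_zero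
      ((he.mul (hsec i)).of_le (by simp)) (hcs fun y hy => by simp [hbs i y hy p]) _
  simp only [hder] at hzero
  simp only [fun i => integral_add (hint i) (hint' i), Finset.sum_add_distrib] at hzero
  rw [← integral_finsetSum _ fun i _ => hint i, ← integral_finsetSum _ fun i _ => hint' i] at hzero
  simp only [← Finset.mul_sum, hsum] at hzero
  rw [integral_const_mul, add_eq_zero_iff_eq_neg] at hzero
  change ‖∫ y, e y * a (y, p)‖ = t⁻¹ * ‖∫ y, e y * ∑ i, fderiv ℝ (b i) (y, p) (Pi.single i 1, 0)‖
  rw [hzero, norm_neg, norm_mul, norm_mul, Complex.norm_I, one_mul, Complex.norm_real,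
    Real.norm_of_nonneg ht.le, inv_mul_cancel_left₀ ht.ne']

/-- Rapid decay of oscillatory integrals without critical points, uniform in parameters. -/
lemma exists_norm_oscillatory_le {Φ : (Fin n → ℝ) × P → ℝ} (hΦ : ContDiff ℝ ∞ Φ)
    {K : Set (Fin n → ℝ)} (hK : IsCompact K) {Q : Set P} (hQ : IsCompact Q)
    (hgrad : ∀ y ∈ K, ∀ p ∈ Q, fderiv ℝ (fun y => Φ (y, p)) y ≠ 0) (N : ℕ)
    {a : (Fin n → ℝ) × P → ℂ} (ha : ContDiff ℝ ∞ a) (hsupp : ∀ y ∉ K, ∀ p, a (y, p) = 0) :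
    ∃ C : ℝ, 0 ≤ C ∧ ∀ p ∈ Q, ∀ t : ℝ, 0 < t →
      ‖∫ y, Complex.exp (Complex.I * t * Φ (y, p)) * a (y, p)‖ ≤ C * (t⁻¹) ^ N := by
  induction N generalizing a with
  | zero =>
    obtain ⟨B, hB⟩ := (hK.prod hQ).exists_bound_of_continuousOn ha.continuous.continuousOn
    refine ⟨|B| * volume.real K, by positivity, fun p hp t _ => ?_⟩
    rw [pow_zero, mul_one, ← setIntegral_eq_integral_of_forall_compl_eq_zero (s := K)
      fun y hy => by rw [hsupp y hy, mul_zero]]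
    refine norm_setIntegral_le_of_norm_le_const hK.measure_lt_top fun y hy => ?_
    rw [norm_mul, show Complex.I * t * Φ (y, p) = ((t * Φ (y, p) : ℝ) : ℂ) * Complex.I by
      push_cast; ring, Complex.norm_exp_ofReal_mul_I, one_mul]
    exact (hB (y, p) ⟨hy, hp⟩).trans (le_abs_self B)
  | succ N ih =>
    obtain ⟨a', ha', hs', h⟩ := exists_integration_by_parts hΦ hK hQ hgrad ha hsupp
    obtain ⟨C, hC0, hC⟩ := ih ha' hs'
    refine ⟨C, hC0, fun p hp t ht => ?_⟩
    rw [h p hp t ht, pow_succ', mul_left_comm]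
    exact mul_le_mul_of_nonneg_left (hC p hp t ht) (by positivity)

end Parameters

lemma integral_eq_prod_mul_integral_comp_mul {n : ℕ} {F : (Fin n → ℝ) → ℂ} (hF : Continuous F)
    {y : Fin n → ℝ} (hy : ∀ i, 0 < y i) :
    ∫ x, F x = ((∏ i, y i : ℝ) : ℂ) * ∫ t, F (t * y) := by
  classical
  have hdet : (Matrix.diagonal y).det = ∏ i, y i := Matrix.det_diagonal
  have hpos : 0 < ∏ i, y i := Finset.prod_pos fun i _ => hy i
  have h := Real.smul_map_diagonal_volume_pi (D := y) (by rw [hdet]; exact hpos.ne')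
  have hm : Measurable (Matrix.toLin' (Matrix.diagonal y)) :=
    (LinearMap.continuous_of_finiteDimensional _).measurable
  conv_lhs => rw [← h]
  rw [integral_smul_measure, integral_map hm.aemeasurable hF.aestronglyMeasurable, hdet,
    abs_of_pos hpos, ENNReal.toReal_ofReal hpos.le, Complex.real_smul]
  congr 2
  funext t
  congr 1
  funext i
  simp [Matrix.mulVec_diagonal, mul_comm]

/-- Averaging a compactly supported function over dilations of the coordinates. -/
lemma integral_mul_integral_eq {n : ℕ} {F : (Fin n → ℝ) → ℂ} (hF : Continuous F)
    (hs : HasCompactSupport F) {χ : (Fin n → ℝ) → ℝ} (hχ : Continuous χ)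
    {K : Set (Fin n → ℝ)} (hK : IsCompact K) (hKpos : ∀ y ∈ K, ∀ i, 1 / 2 ≤ y i)
    (hχK : ∀ y ∉ K, χ y = 0) :
    ((∫ y, χ y : ℝ) : ℂ) * ∫ x, F x =
      ∫ t : Fin n → ℝ, ∫ y, ((χ y * ∏ i, y i : ℝ) : ℂ) * F (t * y) := by
  have hcont : Continuous fun z : (Fin n → ℝ) × (Fin n → ℝ) =>
      ((χ z.2 * ∏ i, z.2 i : ℝ) : ℂ) * F (z.1 * z.2) := by fun_prop
  obtain ⟨R, hR⟩ := hs.isCompact.isBounded.exists_norm_le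
  have hcs : HasCompactSupport fun z : (Fin n → ℝ) × (Fin n → ℝ) =>
      ((χ z.2 * ∏ i, z.2 i : ℝ) : ℂ) * F (z.1 * z.2) := by
    refine HasCompactSupport.intro
      ((isCompact_closedBall (0 : Fin n → ℝ) (2 * |R|)).prod hK) fun z hz => ?_
    by_cases h2 : z.2 ∈ K
    · have h1 : z.1 ∉ Metric.closedBall (0 : Fin n → ℝ) (2 * |R|) := fun h => hz ⟨h, h2⟩
      rw [show F (z.1 * z.2) = 0 from ?_, mul_zero]
      by_contra hne
      refine h1 (mem_closedBall_zero_iff.2 ((pi_norm_le_iff_of_nonneg (by positivity)).2 fun i => ?_))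
      have h3 := (norm_le_pi_norm _ i).trans (hR _ (subset_tsupport F hne))
      rw [Pi.mul_apply, norm_mul, Real.norm_of_nonneg ((by norm_num : (0 : ℝ) ≤ 1 / 2).trans
        (hKpos _ h2 i))] at h3
      have h4 := hKpos _ h2 i
      have h5 := norm_nonneg (z.1 i)
      have h6 := le_abs_self R
      nlinarith
    · simp [hχK _ h2]
  have hint := hcont.integrable_of_hasCompactSupport hcs (μ := volume)
  rw [integral_integral_swap (f := fun t y => ((χ y * ∏ i, y i : ℝ) : ℂ) * F (t * y)) hint,
    ← integral_complex_ofReal, ← integral_mul_const]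
  congr 1
  funext y
  by_cases hy : y ∈ K
  · rw [integral_const_mul, integral_eq_prod_mul_integral_comp_mul hF (y := y) fun i =>
      (by norm_num : (0 : ℝ) < 1 / 2).trans_le (hKpos y hy i)]
    push_cast; ring
  · simp [hχK y hy]

section NewtonPolyhedron

variable {n : ℕ} {f : EuclideanSpace ℝ (Fin n) → ℝ} {S : Finset (Fin n → ℕ)}

lemma dotProduct_mono_right {u x y : Fin n → ℝ} (hu : ∀ i, 0 ≤ u i) (h : x ≤ y) :
    u ⬝ᵥ x ≤ u ⬝ᵥ y :=
  Finset.sum_le_sum fun i _ => mul_le_mul_of_nonneg_left (h i) (hu i)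

lemma exponentPoint_mono {α β : Fin n → ℕ} (h : α ≤ β) : exponentPoint α ≤ exponentPoint β :=
  fun i => by simpa [exponentPoint] using h i

lemma exists_minimal_le (hS : ∀ s, s ∈ S ↔ Minimal (fun α => taylorCoeff f α ≠ 0) s)
    {α : Fin n → ℕ} (hα : taylorCoeff f α ≠ 0) : ∃ s ∈ S, s ≤ α := by
  obtain ⟨s, hs, hm⟩ := exists_minimal_le_of_wellFoundedLT (fun α => taylorCoeff f α ≠ 0) α hα
  exact ⟨s, (hS s).2 hm, hs⟩

lemma newtonPolyhedron_eq (hS : ∀ s, s ∈ S ↔ Minimal (fun α => taylorCoeff f α ≠ 0) s) :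
    newtonPolyhedron f =
      convexHull ℝ (exponentPoint '' (S : Set (Fin n → ℕ))) + Set.Ici (0 : Fin n → ℝ) := by
  have : (⋃ α ∈ {α : Fin n → ℕ | taylorCoeff f α ≠ 0}, Set.Ici (exponentPoint α))
      = exponentPoint '' (S : Set (Fin n → ℕ)) + Set.Ici (0 : Fin n → ℝ) := by
    ext x
    simp only [mem_iUnion, mem_Ici, exists_prop, Set.mem_add, mem_image, Finset.mem_coe]
    constructor
    · rintro ⟨α, hα, hx⟩
      obtain ⟨s, hs, hle⟩ := exists_minimal_le hS hα
      exact ⟨_, ⟨s, hs, rfl⟩, x - exponentPoint s,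
        sub_nonneg.2 ((exponentPoint_mono hle).trans hx), by simp⟩
    · rintro ⟨_, ⟨s, hs, rfl⟩, y, hy, rfl⟩
      exact ⟨s, ((hS s).1 hs).1, le_add_of_nonneg_right hy⟩
  rw [newtonPolyhedron, this, convexHull_add, (convex_Ici (𝕜 := ℝ) (0 : Fin n → ℝ)).convexHull_eq]

lemma isClosed_newtonPolyhedron : IsClosed (newtonPolyhedron f) := by
  set S := (finite_setOf_minimal fun α => taylorCoeff f α ≠ 0).toFinset with hSdef
  have hS : ∀ s, s ∈ S ↔ Minimal (fun α => taylorCoeff f α ≠ 0) s := fun s => by simp [hSdef]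
  rw [newtonPolyhedron_eq hS]
  exact isClosed_Ici.add_left_of_isCompact (Set.Finite.isCompact_convexHull (𝕜 := ℝ) (S.finite_toSet.image _))

lemma exponentPoint_mem_newtonPolyhedron {α : Fin n → ℕ} (hα : taylorCoeff f α ≠ 0) :
    exponentPoint α ∈ newtonPolyhedron f :=
  subset_convexHull _ _ (mem_iUnion₂.2 ⟨α, hα, self_mem_Ici⟩)

lemma add_mem_newtonPolyhedron {x y : Fin n → ℝ} (hx : x ∈ newtonPolyhedron f) (hy : 0 ≤ y) :
    x + y ∈ newtonPolyhedron f := by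
  set S := (finite_setOf_minimal fun α => taylorCoeff f α ≠ 0).toFinset with hSdef
  have hS : ∀ s, s ∈ S ↔ Minimal (fun α => taylorCoeff f α ≠ 0) s := fun s => by simp [hSdef]
  rw [newtonPolyhedron_eq hS] at hx ⊢
  obtain ⟨c, hc, p, hp, rfl⟩ := hx
  exact ⟨c, hc, p + y, add_nonneg hp hy, by simp [add_assoc]⟩

lemma le_dotProduct_of_mem_newtonPolyhedron
    (hS : ∀ s, s ∈ S ↔ Minimal (fun α => taylorCoeff f α ≠ 0) s) {u : Fin n → ℝ}
    (hu : ∀ i, 0 ≤ u i) {m : ℝ} (hm : ∀ s ∈ S, m ≤ u ⬝ᵥ exponentPoint s) {x : Fin n → ℝ}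
    (hx : x ∈ newtonPolyhedron f) : m ≤ u ⬝ᵥ x := by
  rw [newtonPolyhedron_eq hS] at hx
  obtain ⟨c, hc, p, hp, rfl⟩ := hx
  have h1 : convexHull ℝ (exponentPoint '' (S : Set (Fin n → ℕ))) ⊆ {x | m ≤ u ⬝ᵥ x} := by
    refine convexHull_min ?_ (convex_halfSpace_ge
      ⟨fun x y => dotProduct_add _ _ _, fun r x => dotProduct_smul _ _ _⟩ m)
    rintro _ ⟨s, hs, rfl⟩
    exact hm s hs
  have h2 : 0 ≤ u ⬝ᵥ p := by simpa using dotProduct_mono_right hu hp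
  have h3 : m ≤ u ⬝ᵥ c := h1 hc
  rw [dotProduct_add]; linarith

/-- A positive weight exposes a compact face of the Newton polyhedron. -/
lemma isCompactFace_of_weight
    (hS : ∀ s, s ∈ S ↔ Minimal (fun α => taylorCoeff f α ≠ 0) s) {u : Fin n → ℝ}
    (hu : ∀ i, 0 < u i) {D : Fin n → ℝ} (hD : D ∈ newtonPolyhedron f)
    (hm : ∀ s ∈ S, u ⬝ᵥ D ≤ u ⬝ᵥ exponentPoint s) :
    IsCompactFace f {x ∈ newtonPolyhedron f | u ⬝ᵥ x = u ⬝ᵥ D} := by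
  have hu' : ∀ i, 0 ≤ u i := fun i => (hu i).le
  have hcont : Continuous fun x : Fin n → ℝ => u ⬝ᵥ x := by
    unfold dotProduct; fun_prop
  refine ⟨⟨D, hD, rfl⟩, fun _ => ?_, ?_⟩
  · refine ⟨-LinearMap.toContinuousLinearMap (dotProductBilin ℝ ℝ u), ?_⟩
    ext x
    simp only [mem_ofPred_eq, neg_apply, neg_le_neg_iff]
    change _ ∧ u ⬝ᵥ x = u ⬝ᵥ D ↔ _ ∧ ∀ y ∈ newtonPolyhedron f, u ⬝ᵥ x ≤ u ⬝ᵥ y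
    refine and_congr_right fun hx => ⟨fun h y hy => ?_, fun h => ?_⟩
    · rw [h]; exact le_dotProduct_of_mem_newtonPolyhedron hS hu' hm hy
    · exact le_antisymm (h D hD) (le_dotProduct_of_mem_newtonPolyhedron hS hu' hm hx)
  · refine (isCompact_Icc (a := (0 : Fin n → ℝ)) (b := fun i => u ⬝ᵥ D / u i)).of_isClosed_subset
      (isClosed_newtonPolyhedron.inter (isClosed_eq hcont continuous_const)) ?_
    rintro x ⟨hx, hxD⟩
    have h0 : ∀ i, 0 ≤ x i := fun i => by
      have := le_dotProduct_of_mem_newtonPolyhedron hS (u := Pi.single i 1) (m := 0)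
        (fun j => by simp only [Pi.single_apply]; split_ifs <;> norm_num)
        (fun s _ => by simp [exponentPoint]) hx
      simpa using this
    refine ⟨h0, fun i => ?_⟩
    rw [le_div_iff₀ (hu i), ← hxD, mul_comm]
    exact Finset.single_le_sum (f := fun i => u i * x i) (fun i _ => mul_nonneg (hu' i) (h0 i))
      (Finset.mem_univ i)

lemma eq_of_le_of_dotProduct_le {u : Fin n → ℝ} (hu : ∀ i, 0 < u i) {s α : Fin n → ℕ}
    (hle : s ≤ α) (h : u ⬝ᵥ exponentPoint α ≤ u ⬝ᵥ exponentPoint s) : s = α := by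
  by_contra hne
  obtain ⟨i, hi⟩ : ∃ i, s i < α i := by
    by_contra! hcon
    exact hne (le_antisymm hle hcon)
  refine absurd h (not_le.2 (Finset.sum_lt_sum (fun j _ => ?_) ⟨i, Finset.mem_univ i, ?_⟩))
  · exact mul_le_mul_of_nonneg_left (exponentPoint_mono hle j) (hu j).le
  · exact mul_lt_mul_of_pos_left (by simpa [exponentPoint] using hi) (hu i)

/-- The part of `f` on a face exposed by a positive weight only involves minimal exponents. -/
lemma facePart_eq_sum
    (hS : ∀ s, s ∈ S ↔ Minimal (fun α => taylorCoeff f α ≠ 0) s) {u : Fin n → ℝ}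
    (hu : ∀ i, 0 < u i) {m : ℝ} (hm : ∀ s ∈ S, m ≤ u ⬝ᵥ exponentPoint s)
    (x : EuclideanSpace ℝ (Fin n)) :
    facePart f {x ∈ newtonPolyhedron f | u ⬝ᵥ x = m} x =
      ∑ s ∈ S with u ⬝ᵥ exponentPoint s = m, taylorCoeff f s * ∏ i, x i ^ s i := by
  classical
  have hmem : ∀ α, taylorCoeff f α ≠ 0 → u ⬝ᵥ exponentPoint α = m → α ∈ S := fun α hα h => by
    obtain ⟨s, hs, hle⟩ := exists_minimal_le hS hα
    rwa [← eq_of_le_of_dotProduct_le hu hle (h.trans_le (hm s hs))]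
  rw [facePart, finsum_mem_def, finsum_eq_sum_of_support_subset
    (s := S.filter fun s => u ⬝ᵥ exponentPoint s = m)]
  · refine Finset.sum_congr rfl fun s hs => ?_
    rw [Finset.mem_filter] at hs
    have hmem : s ∈ {α : Fin n → ℕ | exponentPoint α ∈ {x ∈ newtonPolyhedron f | u ⬝ᵥ x = m}} :=
      ⟨exponentPoint_mem_newtonPolyhedron ((hS s).1 hs.1).1, hs.2⟩
    rw [Set.indicator_of_mem hmem, monomial]
  · intro α hα
    rw [Function.mem_support] at hα
    have h1 := Set.mem_of_indicator_ne_zero hα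
    rw [Set.indicator_of_mem h1] at hα
    exact Finset.mem_coe.2 (Finset.mem_filter.2 ⟨hmem α (left_ne_zero_of_mul hα) h1.2, h1.2⟩)

/-- A compact face is exposed by a positive weight. -/
lemma exists_weight_of_isCompactFace {γ : Set (Fin n → ℝ)} (hγ : IsCompactFace f γ)
    {D : Fin n → ℝ} (hD : D ∈ γ) :
    ∃ u : Fin n → ℝ, (∀ i, 0 < u i) ∧ (∀ x ∈ newtonPolyhedron f, u ⬝ᵥ D ≤ u ⬝ᵥ x) ∧
      D ∈ newtonPolyhedron f ∧ γ = {x ∈ newtonPolyhedron f | u ⬝ᵥ x = u ⬝ᵥ D} := by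
  obtain ⟨hne, hexp, hcomp⟩ := hγ
  obtain ⟨l, hl⟩ := hexp hne
  let u : Fin n → ℝ := fun i => -l (Pi.single i 1)
  have hul : ∀ x, u ⬝ᵥ x = -l x := fun x => by
    conv_rhs => rw [pi_eq_sum_univ' x]
    simp [u, dotProduct, mul_comm]
  have hD' := hD
  rw [hl] at hD'
  refine ⟨u, fun i => ?_, fun x hx => ?_, hD'.1, ?_⟩
  · by_contra! hui
    obtain ⟨R, hR⟩ := hcomp.isBounded.exists_norm_le
    have hmem : ∀ r : ℝ, 0 ≤ r → D + Pi.single i r ∈ γ := fun r hr => by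
      rw [hl]
      refine ⟨add_mem_newtonPolyhedron hD'.1 (Pi.single_nonneg.2 hr), fun y hy => ?_⟩
      refine (hD'.2 y hy).trans ?_
      have h1 := hul (Pi.single i r)
      rw [dotProduct_single] at h1
      rw [map_add]
      nlinarith
    have h1 := (norm_le_pi_norm _ i).trans (hR _ (hmem (|R| + |D i| + 1) (by positivity)))
    rw [Pi.add_apply, Pi.single_eq_same, Real.norm_eq_abs] at h1
    have := le_abs_self (D i + (|R| + |D i| + 1))
    have := neg_abs_le (D i)
    have := le_abs_self R
    linarith
  · rw [hul, hul]; exact neg_le_neg (hD'.2 x hx)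
  · rw [hl]
    ext x
    refine and_congr_right fun hx => ⟨fun h => ?_, fun h y hy => ?_⟩
    · rw [hul, hul]; exact congrArg _ (le_antisymm (hD'.2 x hx) (h D hD'.1))
    · rw [hul, hul, neg_inj] at h
      rw [h]; exact hD'.2 y hy

/-- Minimality of the principal face: a weight which is minimal at `D` among the exponents of the
face is constant on the face. -/
lemma dotProduct_eq_of_minimal_face
    (hS : ∀ s, s ∈ S ↔ Minimal (fun α => taylorCoeff f α ≠ 0) s) {u D : Fin n → ℝ}
    (hu : ∀ i, 0 < u i) (hD : D ∈ newtonPolyhedron f)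
    (hm : ∀ s ∈ S, u ⬝ᵥ D ≤ u ⬝ᵥ exponentPoint s)
    (hmin : ∀ γ', IsCompactFace f γ' → D ∈ γ' →
      faceDim {x ∈ newtonPolyhedron f | u ⬝ᵥ x = u ⬝ᵥ D} ≤ faceDim γ')
    {w : Fin n → ℝ} (hw : ∀ s ∈ S, u ⬝ᵥ exponentPoint s = u ⬝ᵥ D → w ⬝ᵥ D ≤ w ⬝ᵥ exponentPoint s)
    {x : Fin n → ℝ} (hx : x ∈ newtonPolyhedron f) (hxD : u ⬝ᵥ x = u ⬝ᵥ D) :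
    w ⬝ᵥ x = w ⬝ᵥ D := by
  have hsmall : ∀ A B : ℝ, 0 < A → ∀ᶠ δ in 𝓝[>] (0 : ℝ), 0 < A + δ * B := fun A B hA => by
    have : Tendsto (fun δ : ℝ => A + δ * B) (𝓝 0) (𝓝 (A + 0 * B)) := by
      exact (continuous_const.add (continuous_id.mul continuous_const)).tendsto _
    rw [zero_mul, add_zero] at this
    exact (this.eventually_const_lt hA).filter_mono nhdsWithin_le_nhds
  have h1 : ∀ᶠ δ in 𝓝[>] (0 : ℝ), ∀ i, 0 < u i + δ * w i :=
    eventually_all.2 fun i => hsmall _ _ (hu i)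
  have h2 : ∀ᶠ δ in 𝓝[>] (0 : ℝ), ∀ s ∈ S, (u + δ • w) ⬝ᵥ D ≤ (u + δ • w) ⬝ᵥ exponentPoint s := by
    refine (Finset.eventually_all S).2 fun s hs => ?_
    rcases (hm s hs).eq_or_lt with h | h
    · filter_upwards [self_mem_nhdsWithin] with δ hδ
      have h3 := hw s hs h.symm
      have h4 : (0 : ℝ) < δ := hδ
      simp only [add_dotProduct, smul_dotProduct, smul_eq_mul]
      nlinarith
    · filter_upwards [hsmall (u ⬝ᵥ exponentPoint s - u ⬝ᵥ D) (w ⬝ᵥ exponentPoint s - w ⬝ᵥ D)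
        (by linarith)] with δ hδ
      simp only [add_dotProduct, smul_dotProduct, smul_eq_mul]
      linarith
  have h3 : Tendsto (fun δ : ℝ => 2 * δ) (𝓝[>] 0) (𝓝[>] 0) := by
    refine tendsto_nhdsWithin_iff.2 ⟨?_, ?_⟩
    · have : Tendsto (fun δ : ℝ => 2 * δ) (𝓝 0) (𝓝 (2 * 0)) :=
        (continuous_const.mul continuous_id).tendsto _
      rw [mul_zero] at this
      exact this.mono_left nhdsWithin_le_nhds
    · filter_upwards [self_mem_nhdsWithin] with δ hδ
      simpa using hδ
  obtain ⟨δ, ⟨⟨⟨h1δ, h2δ⟩, h3δ⟩, h4δ⟩, hδ : (0 : ℝ) < δ⟩ :=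
    ((((h1.and h2).and (h3.eventually h1)).and (h3.eventually h2)).and self_mem_nhdsWithin).exists
  have hface := isCompactFace_of_weight hS (u := u + δ • w) h1δ hD h2δ
  set γ' := {x ∈ newtonPolyhedron f | (u + δ • w) ⬝ᵥ x = (u + δ • w) ⬝ᵥ D} with hγ'
  set γ := {x ∈ newtonPolyhedron f | u ⬝ᵥ x = u ⬝ᵥ D} with hγ
  have hDγ' : D ∈ γ' := ⟨hD, rfl⟩
  have hkey : ∀ y ∈ γ', y ∈ γ ∧ w ⬝ᵥ y = w ⬝ᵥ D := by
    rintro y ⟨hy, hyD⟩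
    have h5 := le_dotProduct_of_mem_newtonPolyhedron hS (fun i => (hu i).le) hm hy
    have h6 := le_dotProduct_of_mem_newtonPolyhedron hS (u := u + (2 * δ) • w)
      (fun i => (h3δ i).le) h4δ hy
    simp only [add_dotProduct, smul_dotProduct, smul_eq_mul] at hyD h6
    have h7 : u ⬝ᵥ y = u ⬝ᵥ D := by linarith
    exact ⟨⟨hy, h7⟩, mul_left_cancel₀ hδ.ne' (by linarith)⟩
  have hle : vectorSpan ℝ γ' ≤ vectorSpan ℝ γ := vectorSpan_mono ℝ fun y hy => (hkey y hy).1
  have heq : vectorSpan ℝ γ' = vectorSpan ℝ γ :=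
    Submodule.eq_of_le_of_finrank_le hle (hmin γ' hface hDγ')
  have hxmem : x - D ∈ vectorSpan ℝ γ' := by
    rw [heq]; exact vsub_mem_vectorSpan ℝ ⟨hx, hxD⟩ ⟨hD, rfl⟩
  have hker : vectorSpan ℝ γ' ≤ LinearMap.ker (dotProductBilin ℝ ℝ w : (Fin n → ℝ) →ₗ[ℝ] ℝ) := by
    rw [vectorSpan_def, Submodule.span_le]
    rintro _ ⟨y, hy, z, hz, rfl⟩
    change w ⬝ᵥ (y - z) = 0
    rw [dotProduct_sub, (hkey y hy).2, (hkey z hz).2, sub_self]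
  have h8 : w ⬝ᵥ (x - D) = 0 := hker hxmem
  rw [dotProduct_sub] at h8
  linarith

end NewtonPolyhedron

/-- The sum of the absolute values of the monomials with exponents in `S`. -/
noncomputable def monomialSize {n : ℕ} (S : Finset (Fin n → ℕ)) (t : Fin n → ℝ) : ℝ :=
  ∑ s ∈ S, |∏ i, t i ^ s i|

/-- The monomials with exponents in `S`, normalized by their size. -/
noncomputable def monomialDirection {n : ℕ} (S : Finset (Fin n → ℕ)) (t : Fin n → ℝ) : S → ℝ :=
  fun s => (∏ i, t i ^ (s : Fin n → ℕ) i) / monomialSize S t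

section

variable {n : ℕ} {S : Finset (Fin n → ℕ)}

lemma monomial_ne_zero {t : Fin n → ℝ} (ht : ∀ i, t i ≠ 0) (s : Fin n → ℕ) : ∏ i, t i ^ s i ≠ 0 :=
  Finset.prod_ne_zero_iff.2 fun i _ => pow_ne_zero _ (ht i)

lemma monomialSize_pos (hS : S.Nonempty) {t : Fin n → ℝ} (ht : ∀ i, t i ≠ 0) :
    0 < monomialSize S t :=
  Finset.sum_pos (fun s _ => abs_pos.2 (monomial_ne_zero ht s)) hS

lemma sum_abs_monomialDirection (hS : S.Nonempty) {t : Fin n → ℝ} (ht : ∀ i, t i ≠ 0) :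
    ∑ s, |monomialDirection S t s| = 1 := by
  have h := monomialSize_pos hS ht
  simp only [monomialDirection, abs_div, ← Finset.sum_div, abs_of_pos h]
  rw [div_eq_one_iff_eq h.ne', monomialSize]
  exact Finset.sum_coe_sort S fun s => |∏ i, t i ^ s i|

lemma exists_pseudoinverse {V W : Type*} [AddCommGroup V] [Module ℝ V] [AddCommGroup W]
    [Module ℝ W] (A : V →ₗ[ℝ] W) : ∃ B : W →ₗ[ℝ] V, ∀ v, A (B (A v)) = A v := by
  obtain ⟨g, hg⟩ := A.rangeRestrict.exists_rightInverse_of_surjective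
    (LinearMap.range_eq_top.2 A.surjective_rangeRestrict)
  obtain ⟨B, hB⟩ := LinearMap.exists_extend g
  refine ⟨B, fun v => ?_⟩
  have h1 : B (A v) = g (A.rangeRestrict v) := LinearMap.congr_fun hB (A.rangeRestrict v)
  rw [h1]
  exact congrArg Subtype.val (LinearMap.congr_fun hg (A.rangeRestrict v))

lemma monomial_sign_mul_exp (ε x : Fin n → ℝ) (s : Fin n → ℕ) :
    ∏ i, (ε i * Real.exp (-x i)) ^ s i = (∏ i, ε i ^ s i) * Real.exp (-(x ⬝ᵥ exponentPoint s)) := by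
  simp only [mul_pow, Finset.prod_mul_distrib, ← Real.exp_nat_mul, ← Real.exp_sum]
  congr 2
  simp only [dotProduct, exponentPoint, ← Finset.sum_neg_distrib]
  exact Finset.sum_congr rfl fun i _ => by ring

/-- Limits of normalized monomials at the origin live on a face exposed by a positive weight,
where they are again given by monomials. -/
lemma exists_weight_of_mem_closure (hS : S.Nonempty) {c : S → ℝ}
    (hc : (c, (0 : Fin n → ℝ)) ∈
      closure {z : (S → ℝ) × (Fin n → ℝ) | (∀ i, z.2 i ≠ 0) ∧ z.1 = monomialDirection S z.2}) :
    ∃ (u v : Fin n → ℝ) (κ : ℝ) (α : S), (∀ i, 0 < u i) ∧ (∀ i, v i ≠ 0) ∧ κ ≠ 0 ∧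
      (∀ s ∈ S, u ⬝ᵥ exponentPoint (α : Fin n → ℕ) ≤ u ⬝ᵥ exponentPoint s) ∧
      ∀ s : S, c s = if u ⬝ᵥ exponentPoint (s : Fin n → ℕ) = u ⬝ᵥ exponentPoint (α : Fin n → ℕ)
        then κ * ∏ i, v i ^ (s : Fin n → ℕ) i else 0 := by
  classical
  obtain ⟨𝒰, hmem, hle⟩ := mem_closure_iff_ultrafilter.1 hc
  have hz : ∀ᶠ z in (𝒰 : Filter ((S → ℝ) × (Fin n → ℝ))),
    (∀ i, z.2 i ≠ 0) ∧ z.1 = monomialDirection S z.2 := hmem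
  have hlim1 : Tendsto (fun z : (S → ℝ) × (Fin n → ℝ) => z.1) 𝒰 (𝓝 c) :=
    (continuous_fst.tendsto (c, (0 : Fin n → ℝ))).mono_left hle
  have hlim2 : Tendsto (fun z : (S → ℝ) × (Fin n → ℝ) => z.2) 𝒰 (𝓝 0) :=
    (continuous_snd.tendsto (c, (0 : Fin n → ℝ))).mono_left hle
  have hcs : ∀ s, Tendsto (fun z : (S → ℝ) × (Fin n → ℝ) => z.1 s) 𝒰 (𝓝 (c s)) :=
    fun s => (tendsto_pi_nhds.1 hlim1) s
  have hsum : ∑ s, |c s| = 1 := by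
    have h1 : Tendsto (fun z : (S → ℝ) × (Fin n → ℝ) => ∑ s, |z.1 s|) 𝒰 (𝓝 (∑ s, |c s|)) :=
      tendsto_finsetSum _ fun s _ => (hcs s).abs
    refine tendsto_nhds_unique_of_eventuallyEq h1 (tendsto_const_nhds (x := (1 : ℝ))) ?_
    filter_upwards [hz] with z hz
    rw [hz.2]; exact sum_abs_monomialDirection hS hz.1
  obtain ⟨α, hα⟩ : ∃ α, c α ≠ 0 := by
    by_contra! hcon
    simp [hcon] at hsum
  have hsign : ∀ i, ∃ ε : ℝ, (ε = 1 ∨ ε = -1) ∧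
      ∀ᶠ z in (𝒰 : Filter ((S → ℝ) × (Fin n → ℝ))), z.2 i = ε * |z.2 i| := fun i => by
    have : ∀ᶠ z in (𝒰 : Filter ((S → ℝ) × (Fin n → ℝ))), 0 ≤ z.2 i ∨ z.2 i ≤ 0 :=
      Eventually.of_forall fun z => le_total _ _
    rcases Ultrafilter.eventually_or.1 this with h | h
    · exact ⟨1, Or.inl rfl, h.mono fun z hz => by rw [abs_of_nonneg hz, one_mul]⟩
    · exact ⟨-1, Or.inr rfl, h.mono fun z hz => by rw [abs_of_nonpos hz]; ring⟩
  choose ε hε hεz using hsign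
  have hε0 : ∀ i, ε i ≠ 0 := fun i => by rcases hε i with h | h <;> rw [h] <;> norm_num
  have hεabs : ∀ s : Fin n → ℕ, |∏ i, ε i ^ s i| = 1 := fun s => by
    rw [Finset.abs_prod]
    refine Finset.prod_eq_one fun i _ => ?_
    rw [abs_pow]
    rcases hε i with h | h <;> simp [h]
  let w : (S → ℝ) × (Fin n → ℝ) → Fin n → ℝ := fun z i => -Real.log |z.2 i|
  let r : S → ℝ := fun s => (∏ i, ε i ^ (s : Fin n → ℕ) i) / ∏ i, ε i ^ (α : Fin n → ℕ) i
  have hrabs : ∀ s, |r s| = 1 := fun s => by simp only [r, abs_div, hεabs, div_one]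
  let ξ : S → Fin n → ℝ := fun s =>
    exponentPoint (s : Fin n → ℕ) - exponentPoint (α : Fin n → ℕ)
  have hratio : ∀ (x : Fin n → ℝ) (s : S), (∏ i, (ε i * Real.exp (-x i)) ^ (s : Fin n → ℕ) i) /
      (∏ i, (ε i * Real.exp (-x i)) ^ (α : Fin n → ℕ) i) = r s * Real.exp (-(x ⬝ᵥ ξ s)) := by
    intro x s
    rw [monomial_sign_mul_exp, monomial_sign_mul_exp, mul_div_mul_comm, ← Real.exp_sub]
    congr 2
    simp only [ξ, dotProduct_sub]; ring
  have hzr : ∀ᶠ z in (𝒰 : Filter ((S → ℝ) × (Fin n → ℝ))), ∀ s,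
      z.1 s / z.1 α = r s * Real.exp (-(w z ⬝ᵥ ξ s)) := by
    filter_upwards [hz, eventually_all.2 hεz] with z hz hε s
    have hzt : z.2 = fun i => ε i * Real.exp (-w z i) := by
      funext i
      simp only [w, neg_neg]
      rw [Real.exp_log (abs_pos.2 (hz.1 i))]
      exact hε i
    rw [← hratio, hz.2]
    simp only [monomialDirection]
    rw [div_div_div_cancel_right₀ (monomialSize_pos hS hz.1).ne']
    conv_lhs => rw [hzt]
  have hlimr : ∀ s, Tendsto (fun z => r s * Real.exp (-(w z ⬝ᵥ ξ s))) 𝒰 (𝓝 (c s / c α)) :=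
    fun s => ((hcs s).div (hcs α) hα).congr' (hzr.mono fun z hz => hz s)
  have hlimexp : ∀ s, Tendsto (fun z => Real.exp (-(w z ⬝ᵥ ξ s))) 𝒰 (𝓝 |c s / c α|) := fun s => by
    refine (hlimr s).abs.congr fun z => ?_
    rw [abs_mul, hrabs, one_mul, Real.abs_exp]
  have hlimin : ∀ s, c s ≠ 0 → Tendsto (fun z => w z ⬝ᵥ ξ s) 𝒰 (𝓝 (-Real.log |c s / c α|)) :=
    fun s hs => by
      have := ((Real.continuousAt_log (abs_ne_zero.2 (div_ne_zero hs hα))).tendsto.comp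
        (hlimexp s)).neg
      refine this.congr fun z => ?_
      simp
  have hlimout : ∀ s, c s = 0 → Tendsto (fun z => w z ⬝ᵥ ξ s) 𝒰 atTop := fun s hs => by
    have h1 := hlimexp s
    rw [hs, zero_div, abs_zero] at h1
    have h2 := Real.tendsto_exp_comp_nhds_zero.1 h1
    exact tendsto_neg_atBot_iff.1 h2
  let A : (Fin n → ℝ) →ₗ[ℝ] (S → ℝ) := LinearMap.pi fun s =>
    if c s ≠ 0 then (dotProductBilin ℝ ℝ (ξ s) : (Fin n → ℝ) →ₗ[ℝ] ℝ) else 0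
  have hA : ∀ x s, A x s = if c s ≠ 0 then x ⬝ᵥ ξ s else 0 := fun x s => by
    simp only [A, LinearMap.pi_apply]
    split_ifs
    · exact dotProduct_comm (ξ s) x
    · rfl
  obtain ⟨B, hB⟩ := exists_pseudoinverse A
  have hAc : Continuous A := LinearMap.continuous_of_finiteDimensional A
  have hBc : Continuous B := LinearMap.continuous_of_finiteDimensional B
  let ℓ : S → ℝ := fun s => if c s ≠ 0 then -Real.log |c s / c α| else 0
  have hAw : Tendsto (fun z => A (w z)) 𝒰 (𝓝 ℓ) := by
    refine tendsto_pi_nhds.2 fun s => ?_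
    simp only [hA, ℓ]
    split_ifs with h
    · exact hlimin s h
    · exact tendsto_const_nhds
  have hBAw : Tendsto (fun z => B (A (w z))) 𝒰 (𝓝 (B ℓ)) := (hBc.tendsto _).comp hAw
  have hABℓ : A (B ℓ) = ℓ := by
    refine tendsto_nhds_unique ((hAc.tendsto _).comp hBAw) (hAw.congr fun z => ?_)
    exact (hB _).symm
  have hw : ∀ i, Tendsto (fun z => w z i) 𝒰 atTop := fun i => by
    have h1 : Tendsto (fun z : (S → ℝ) × (Fin n → ℝ) => z.2 i) 𝒰 (𝓝[≠] 0) :=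
      tendsto_nhdsWithin_iff.2 ⟨(tendsto_pi_nhds.1 hlim2) i, hz.mono fun z hz => hz.1 i⟩
    have h2 := Real.tendsto_log_nhdsNE_zero.comp h1
    refine tendsto_neg_atBot_iff.1 (h2.congr fun z => ?_)
    simp [w, Real.log_abs]
  have hu1 : ∀ᶠ z in (𝒰 : Filter ((S → ℝ) × (Fin n → ℝ))), ∀ i, 0 < (w z - B (A (w z))) i :=
    eventually_all.2 fun i => by
      have h1 := (hw i).atTop_add ((tendsto_pi_nhds.1 hBAw) i).neg
      filter_upwards [h1.eventually_gt_atTop 0] with z hz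
      simpa [sub_eq_add_neg] using hz
  have hu2 : ∀ᶠ z in (𝒰 : Filter ((S → ℝ) × (Fin n → ℝ))), ∀ s, c s = 0 →
      0 < (w z - B (A (w z))) ⬝ᵥ ξ s := eventually_all.2 fun s => by
    by_cases hs : c s = 0
    · have h2 : Continuous fun x : Fin n → ℝ => x ⬝ᵥ ξ s := by unfold dotProduct; fun_prop
      have h1 := (hlimout s hs).atTop_add ((h2.tendsto _).comp hBAw).neg
      filter_upwards [h1.eventually_gt_atTop 0] with z hz _
      rw [sub_dotProduct]
      simpa [sub_eq_add_neg] using hz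
    · exact Eventually.of_forall fun z h => absurd h hs
  obtain ⟨z, hz1, hz2⟩ := (hu1.and hu2).exists
  set u := w z - B (A (w z)) with hudef
  have hAu : A u = 0 := by rw [hudef, map_sub, hB, sub_self]
  have hu0 : ∀ s, c s ≠ 0 → u ⬝ᵥ ξ s = 0 := fun s hs => by
    have := congrFun hAu s
    rwa [hA, if_pos hs] at this
  let v : Fin n → ℝ := fun i => ε i * Real.exp (-B ℓ i)
  have hv : ∀ i, v i ≠ 0 := fun i => mul_ne_zero (hε0 i) (Real.exp_ne_zero _)
  have hvα := monomial_ne_zero hv (α : Fin n → ℕ)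
  refine ⟨u, v, c α / ∏ i, v i ^ (α : Fin n → ℕ) i, α, hz1, hv, div_ne_zero hα hvα, ?_, ?_⟩
  · intro s hs
    have h1 : 0 ≤ u ⬝ᵥ ξ ⟨s, hs⟩ := by
      by_cases h : c ⟨s, hs⟩ = 0
      · exact (hz2 _ h).le
      · exact (hu0 _ h).ge
    simp only [ξ, dotProduct_sub] at h1
    linarith
  · intro s
    by_cases hs : c s = 0
    · have h1 := hz2 s hs
      simp only [ξ, dotProduct_sub] at h1
      rw [if_neg (by linarith), hs]
    · have h1 := hu0 s hs
      simp only [ξ, dotProduct_sub] at h1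
      rw [if_pos (by linarith)]
      have h2 : c s / c α = r s * Real.exp (-(B ℓ ⬝ᵥ ξ s)) := by
        refine tendsto_nhds_unique (hlimr s) ?_
        have h3 := congrFun hABℓ s
        rw [hA, if_pos hs] at h3
        rw [h3]
        have h4 := (tendsto_pi_nhds.1 hAw) s
        simp only [hA, if_pos hs] at h4
        exact tendsto_const_nhds.mul ((Real.continuous_exp.tendsto _).comp h4.neg)
      rw [← hratio] at h2
      change c s / c α = (∏ i, v i ^ (s : Fin n → ℕ) i) / ∏ i, v i ^ (α : Fin n → ℕ) i at h2
      rw [div_mul_eq_mul_div, mul_div_assoc, ← h2, mul_div_cancel₀ _ hα]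

end

/-- The rescaled phase `∑ c_s y^s G_s(t y)`, depending on the parameters `c` and `t`. -/
noncomputable def rescaledPhase {n : ℕ} (S : Finset (Fin n → ℕ))
    (G : (Fin n → ℕ) → (Fin n → ℝ) → ℝ) (z : (Fin n → ℝ) × ((S → ℝ) × (Fin n → ℝ))) : ℝ :=
  ∑ s : S, z.2.1 s * ((∏ i, z.1 i ^ (s : Fin n → ℕ) i) * G s (z.2.2 * z.1))

/-- The parameters `(c, t)` with `c` the normalized monomials at `t`. -/
def parameterSet {n : ℕ} (S : Finset (Fin n → ℕ)) : Set ((S → ℝ) × (Fin n → ℝ)) :=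
  {z | (∀ i, z.2 i ≠ 0) ∧ z.1 = monomialDirection S z.2}

section

variable {n : ℕ} {S : Finset (Fin n → ℕ)} {G : (Fin n → ℕ) → (Fin n → ℝ) → ℝ}

lemma contDiff_mul_pi : ContDiff ℝ ∞ fun z : (Fin n → ℝ) × (Fin n → ℝ) => z.1 * z.2 := by
  rw [contDiff_pi]
  intro i
  simp only [Pi.mul_apply]
  fun_prop

lemma contDiff_rescaledPhase (hG : ∀ s, ContDiff ℝ ∞ (G s)) : ContDiff ℝ ∞ (rescaledPhase S G) := by
  refine ContDiff.sum fun s _ => ContDiff.mul (by fun_prop) (ContDiff.mul ?_ ?_)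
  · exact contDiff_prod fun i _ => by fun_prop
  · exact (hG s).comp (contDiff_mul_pi.comp
      ((contDiff_snd.comp contDiff_snd).prodMk contDiff_fst))

lemma monomial_mul (s : Fin n → ℕ) (x y : Fin n → ℝ) :
    ∏ i, (x * y) i ^ s i = (∏ i, x i ^ s i) * ∏ i, y i ^ s i := by
  simp [mul_pow, Finset.prod_mul_distrib]

lemma monomialSize_mul_rescaledPhase (hS : S.Nonempty) {t : Fin n → ℝ} (ht : ∀ i, t i ≠ 0)
    (y : Fin n → ℝ) :
    monomialSize S t * rescaledPhase S G (y, (monomialDirection S t, t)) =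
      ∑ s ∈ S, (∏ i, (t * y) i ^ s i) * G s (t * y) := by
  have h := (monomialSize_pos hS ht).ne'
  rw [rescaledPhase, Finset.mul_sum, ← Finset.sum_coe_sort S]
  refine Finset.sum_congr rfl fun s _ => ?_
  simp only [monomialDirection]
  rw [monomial_mul, ← mul_assoc, mul_div_cancel₀ _ h, mul_assoc]

lemma isCompact_parameterSet (hS : S.Nonempty) (ρ : ℝ) :
    IsCompact (closure (parameterSet S) ∩ {z | ‖z.2‖ ≤ ρ}) := by
  refine ((isCompact_closedBall (0 : S → ℝ) 1).prod
    (isCompact_closedBall (0 : Fin n → ℝ) ρ)).of_isClosed_subset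
    (isClosed_closure.inter (isClosed_le (by fun_prop) continuous_const)) ?_
  have h1 : closure (parameterSet S) ⊆ {z | ‖z.1‖ ≤ 1} := by
    refine closure_minimal ?_ (isClosed_le (by fun_prop) continuous_const)
    rintro ⟨c, t⟩ ⟨ht, hc : c = monomialDirection S t⟩
    subst hc
    refine (pi_norm_le_iff_of_nonneg zero_le_one).2 fun s => ?_
    rw [← sum_abs_monomialDirection hS ht]
    exact Finset.single_le_sum (f := fun s => |monomialDirection S t s|)
      (fun _ _ => abs_nonneg _) (Finset.mem_univ s)
  rintro z ⟨hz, hz2⟩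
  exact ⟨mem_closedBall_zero_iff.2 (h1 hz), mem_closedBall_zero_iff.2 hz2⟩

variable {f : EuclideanSpace ℝ (Fin n) → ℝ}

lemma fderiv_rescaledPhase_ne_zero (hnd : IsNondegenerate f)
    (hS : ∀ s, s ∈ S ↔ Minimal (fun α => taylorCoeff f α ≠ 0) s) (hSne : S.Nonempty)
    (hG : ∀ s, ContDiff ℝ ∞ (G s)) (hG0 : ∀ s ∈ S, G s 0 = taylorCoeff f s)
    {c : S → ℝ} (hc : (c, (0 : Fin n → ℝ)) ∈ closure (parameterSet S))
    {y : Fin n → ℝ} (hy : ∀ i, y i ≠ 0) :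
    fderiv ℝ (fun y => rescaledPhase S G (y, (c, 0))) y ≠ 0 := by
  intro hzero
  obtain ⟨u, v, κ, α, hu, hv, hκ, hmin, hcs⟩ := exists_weight_of_mem_closure hSne hc
  have hαN := exponentPoint_mem_newtonPolyhedron ((hS α).1 α.2).1
  refine hnd _ (isCompactFace_of_weight hS hu hαN hmin) (WithLp.toLp 2 (v * y))
    (fun i => mul_ne_zero (hv i) (hy i)) ?_
  let L : EuclideanSpace ℝ (Fin n) → (Fin n → ℝ) := fun x i => (v i)⁻¹ * x i
  have hL : Differentiable ℝ L := by
    rw [differentiable_pi]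
    intro i
    simp only [L]
    fun_prop
  have hLy : L (WithLp.toLp 2 (v * y)) = y := by
    funext i
    simp [L, hv i]
  have hfun : facePart f {x ∈ newtonPolyhedron f | u ⬝ᵥ x = u ⬝ᵥ exponentPoint (α : Fin n → ℕ)} =
      fun x => κ⁻¹ * rescaledPhase S G (L x, (c, 0)) := by
    funext x
    rw [facePart_eq_sum hS hu hmin, Finset.sum_filter, rescaledPhase, Finset.mul_sum,
      ← Finset.sum_coe_sort S]
    refine Finset.sum_congr rfl fun s _ => ?_
    simp only [hcs s, zero_mul]
    split_ifs with h
    · rw [hG0 s s.2]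
      have h1 : ∏ i, x i ^ (s : Fin n → ℕ) i =
          (∏ i, v i ^ (s : Fin n → ℕ) i) * ∏ i, L x i ^ (s : Fin n → ℕ) i := by
        rw [← monomial_mul]
        refine Finset.prod_congr rfl fun i _ => ?_
        simp [L, hv i]
      rw [h1]
      field_simp
    · simp
  have hd : HasFDerivAt (fun y => rescaledPhase S G (y, (c, 0)))
      (0 : (Fin n → ℝ) →L[ℝ] ℝ) (L (WithLp.toLp 2 (v * y))) := by
    rw [hLy, ← hzero]
    have : ContDiff ℝ ∞ fun y => rescaledPhase S G (y, (c, 0)) :=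
      (contDiff_rescaledPhase hG).comp (contDiff_id.prodMk contDiff_const)
    exact (this.differentiable (by simp) y).hasFDerivAt
  have hcomp := (hd.comp _ (hL _).hasFDerivAt).const_mul κ⁻¹
  rw [ContinuousLinearMap.zero_comp, smul_zero] at hcomp
  rw [hfun, gradient]
  have h2 : fderiv ℝ (fun x => κ⁻¹ * rescaledPhase S G (L x, (c, 0))) (WithLp.toLp 2 (v * y)) = 0 :=
    hcomp.fderiv
  rw [h2, map_zero]

/-- Near `t = 0` the rescaled phase has no critical points on a compact subset of the torus. -/
lemma exists_radius_fderiv_ne_zero (hnd : IsNondegenerate f)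
    (hS : ∀ s, s ∈ S ↔ Minimal (fun α => taylorCoeff f α ≠ 0) s) (hSne : S.Nonempty)
    (hG : ∀ s, ContDiff ℝ ∞ (G s)) (hG0 : ∀ s ∈ S, G s 0 = taylorCoeff f s)
    {K : Set (Fin n → ℝ)} (hK : IsCompact K) (hKne : ∀ y ∈ K, ∀ i, y i ≠ 0) :
    ∃ ρ : ℝ, 0 < ρ ∧ ρ ≤ 1 ∧ ∀ y ∈ K, ∀ z ∈ closure (parameterSet S) ∩ {z | ‖z.2‖ ≤ ρ},
      fderiv ℝ (fun y => rescaledPhase S G (y, z)) y ≠ 0 := by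
  let D : (Fin n → ℝ) × ((S → ℝ) × (Fin n → ℝ)) → (Fin n → ℝ) →L[ℝ] ℝ := fun q =>
    fderiv ℝ (fun y => rescaledPhase S G (y, q.2)) q.1
  have hD : Continuous D := by
    have h1 : D = fun q => (fderiv ℝ (rescaledPhase S G) q).comp
        (ContinuousLinearMap.inl ℝ (Fin n → ℝ) ((S → ℝ) × (Fin n → ℝ))) :=
      funext fun q => (hasFDerivAt_section (contDiff_rescaledPhase hG) q.2 q.1).fderiv
    rw [h1]
    exact ((contDiff_rescaledPhase hG).continuous_fderiv (by simp)).clm_comp continuous_const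
  let Z := (K ×ˢ (closure (parameterSet S) ∩ {z | ‖z.2‖ ≤ 1})) ∩ {q | D q = 0}
  have hZ : IsCompact Z :=
    (hK.prod (isCompact_parameterSet hSne 1)).inter_right (isClosed_eq hD continuous_const)
  rcases Z.eq_empty_or_nonempty with h | h
  · refine ⟨1, one_pos, le_rfl, fun y hy z hz h0 => ?_⟩
    have : (y, z) ∈ Z := ⟨⟨hy, hz⟩, h0⟩
    rw [h] at this
    exact this
  · obtain ⟨q, hq, hmin⟩ := hZ.exists_isMinOn h
      (f := fun q : (Fin n → ℝ) × ((S → ℝ) × (Fin n → ℝ)) => ‖q.2.2‖) (by fun_prop)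
    have hpos : 0 < ‖q.2.2‖ := by
      rw [norm_pos_iff]
      intro h0
      obtain ⟨y, c, t⟩ := q
      obtain rfl : t = 0 := h0
      exact fderiv_rescaledPhase_ne_zero hnd hS hSne hG hG0 hq.1.2.1 (hKne y hq.1.1) hq.2
    have hq1 : ‖q.2.2‖ ≤ 1 := hq.1.2.2
    refine ⟨‖q.2.2‖ / 2, by positivity, by linarith, fun y hy z hz h0 => ?_⟩
    have hz2 : ‖z.2‖ ≤ ‖q.2.2‖ / 2 := hz.2
    have hm : (y, z) ∈ Z := ⟨⟨hy, hz.1, hz2.trans (by linarith)⟩, h0⟩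
    have : ‖q.2.2‖ ≤ ‖z.2‖ := hmin hm
    linarith

/-- Decay of the localized oscillatory integrals in terms of the size of the monomials. -/
lemma exists_norm_localized_le (hSne : S.Nonempty) (hG : ∀ s, ContDiff ℝ ∞ (G s))
    {K : Set (Fin n → ℝ)} (hK : IsCompact K) {ρ : ℝ}
    (hρ : ∀ y ∈ K, ∀ z ∈ closure (parameterSet S) ∩ {z | ‖z.2‖ ≤ ρ},
      fderiv ℝ (fun y => rescaledPhase S G (y, z)) y ≠ 0)
    {χ : (Fin n → ℝ) → ℝ} (hχ : ContDiff ℝ ∞ χ) (hχK : ∀ y ∉ K, χ y = 0)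
    {φ : (Fin n → ℝ) → ℂ} (hφ : ContDiff ℝ ∞ φ) (N : ℕ) :
    ∃ C : ℝ, 0 ≤ C ∧ ∀ t : Fin n → ℝ, (∀ i, t i ≠ 0) → ‖t‖ ≤ ρ → ∀ r : ℝ, 0 < r →
      ‖∫ y, ((χ y : ℝ) : ℂ) * (Complex.exp (Complex.I * r *
        ((∑ s ∈ S, (∏ i, (t * y) i ^ s i) * G s (t * y) : ℝ) : ℂ)) * φ (t * y))‖ ≤
      C * ((r * monomialSize S t)⁻¹) ^ N := by
  have ha : ContDiff ℝ ∞ fun z : (Fin n → ℝ) × ((S → ℝ) × (Fin n → ℝ)) =>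
      ((χ z.1 : ℝ) : ℂ) * φ (z.2.2 * z.1) :=
    (Complex.ofRealCLM.contDiff.comp (hχ.comp contDiff_fst)).mul
      (hφ.comp (contDiff_mul_pi.comp ((contDiff_snd.comp contDiff_snd).prodMk contDiff_fst)))
  obtain ⟨C, hC0, hC⟩ := exists_norm_oscillatory_le (contDiff_rescaledPhase hG) hK
    (isCompact_parameterSet hSne ρ) hρ N ha (fun y hy p => by simp [hχK y hy])
  refine ⟨C, hC0, fun t ht htρ r hr => ?_⟩
  have hM := monomialSize_pos hSne ht
  have h := hC (monomialDirection S t, t) ⟨subset_closure ⟨ht, rfl⟩, htρ⟩ (r * monomialSize S t)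
    (by positivity)
  refine le_trans (le_of_eq ?_) h
  congr 2
  funext y
  rw [← monomialSize_mul_rescaledPhase hSne ht]
  push_cast
  ring_nf

end

lemma integrable_exp_neg_abs_real : Integrable fun x : ℝ => Real.exp (-|x|) := by
  rw [← integrableOn_univ, ← Iic_union_Ioi (a := (0 : ℝ))]
  refine IntegrableOn.union ?_ ?_
  · refine (integrableOn_exp_Iic 0).congr_fun (fun x hx => ?_) measurableSet_Iic
    rw [abs_of_nonpos hx, neg_neg]
  · refine (integrableOn_exp_neg_Ioi 0).congr_fun (fun x hx => ?_) measurableSet_Ioi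
    rw [abs_of_pos hx]

lemma integrable_exp_neg_mul_abs_sub {κ : ℝ} (hκ : 0 < κ) (z : ℝ) :
    Integrable fun x : ℝ => Real.exp (-(κ * |x - z|)) := by
  refine ((integrable_exp_neg_abs_real.comp_mul_left' hκ.ne').comp_sub_right z).congr
    (Eventually.of_forall fun x => ?_)
  simp [abs_mul, abs_of_pos hκ]

lemma integral_exp_neg_mul_abs_sub {κ : ℝ} (hκ : 0 < κ) (z : ℝ) :
    ∫ x : ℝ, Real.exp (-(κ * |x - z|)) = κ⁻¹ * ∫ x : ℝ, Real.exp (-|x|) := by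
  rw [integral_sub_right_eq_self (fun x : ℝ => Real.exp (-(κ * |x|))) z]
  have := Measure.integral_comp_mul_left (fun x : ℝ => Real.exp (-|x|)) κ
  rw [abs_of_pos (inv_pos.2 hκ), smul_eq_mul] at this
  rw [← this]
  simp [abs_mul, abs_of_pos hκ]

/-- The integral of a product of exponentials of linearly independent functionals. -/
lemma exists_lintegral_prod_exp_le {n : ℕ} {b : Fin n → Fin n → ℝ} (hb : LinearIndependent ℝ b) :
    ∃ C : ℝ, 0 ≤ C ∧ ∀ κ z : Fin n → ℝ, (∀ i, 0 < κ i) →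
      ∫⁻ w : Fin n → ℝ, ENNReal.ofReal (∏ i, Real.exp (-(κ i * |b i ⬝ᵥ w - z i|))) ≤
        ENNReal.ofReal (C * ∏ i, (κ i)⁻¹) := by
  classical
  let M : Matrix (Fin n) (Fin n) ℝ := Matrix.of b
  have hM : IsUnit M := Matrix.linearIndependent_rows_iff_isUnit.1 hb
  have hdet : LinearMap.det (Matrix.toLin' M) ≠ 0 := by
    rw [LinearMap.det_toLin']
    exact ((Matrix.isUnit_iff_isUnit_det _).1 hM).ne_zero
  set q : ℝ := |(LinearMap.det (Matrix.toLin' M))⁻¹| with hq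
  refine ⟨q * (∫ x : ℝ, Real.exp (-|x|)) ^ n,
    mul_nonneg (abs_nonneg _) (pow_nonneg (integral_nonneg fun _ => (Real.exp_pos _).le) _),
    fun κ z hκ => le_of_eq ?_⟩
  have hmap := Real.map_linearMap_volume_pi_eq_smul_volume_pi hdet
  have hm : Measurable (Matrix.toLin' M) :=
    (LinearMap.continuous_of_finiteDimensional _).measurable
  have hg : Measurable fun x : Fin n → ℝ =>
      ENNReal.ofReal (∏ i, Real.exp (-(κ i * |x i - z i|))) := by fun_prop
  calc ∫⁻ w : Fin n → ℝ, ENNReal.ofReal (∏ i, Real.exp (-(κ i * |b i ⬝ᵥ w - z i|)))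
      = ∫⁻ x, ENNReal.ofReal (∏ i, Real.exp (-(κ i * |x i - z i|)))
          ∂(Measure.map (Matrix.toLin' M) volume) := (lintegral_map hg hm).symm
    _ = ENNReal.ofReal q *
          ∫⁻ x : Fin n → ℝ, ENNReal.ofReal (∏ i, Real.exp (-(κ i * |x i - z i|))) := by
        rw [hmap, lintegral_smul_measure, smul_eq_mul]
    _ = ENNReal.ofReal q * ENNReal.ofReal (∏ i, ((κ i)⁻¹ * ∫ x : ℝ, Real.exp (-|x|))) := by
        have hint : Integrable (fun x : Fin n → ℝ => ∏ i, Real.exp (-(κ i * |x i - z i|))) volume :=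
          Integrable.fintype_prod (f := fun i (x : ℝ) => Real.exp (-(κ i * |x - z i|)))
            fun i => integrable_exp_neg_mul_abs_sub (hκ i) (z i)
        rw [← ofReal_integral_eq_lintegral_ofReal hint
          (Eventually.of_forall fun x => Finset.prod_nonneg fun i _ => (Real.exp_pos _).le),
          integral_fintype_prod_volume_eq_prod
            (fun i (x : ℝ) => Real.exp (-(κ i * |x - z i|)))]
        simp only [fun i => integral_exp_neg_mul_abs_sub (hκ i) (z i)]
    _ = _ := by
        rw [← ENNReal.ofReal_mul (abs_nonneg _), Finset.prod_mul_distrib, Finset.prod_const,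
          Finset.card_univ, Fintype.card_fin]
        congr 1; ring

lemma exists_adapted_basis {n k : ℕ} {X : Set (Fin n → ℝ)}
    (h1 : (1 : Fin n → ℝ) ∉ Submodule.span ℝ X)
    (hk : n ≤ Module.finrank ℝ (Submodule.span ℝ X) + k) :
    ∃ (b : Fin n → Fin n → ℝ) (i₀ : Fin n) (J : Finset (Fin n)), LinearIndependent ℝ b ∧
      b i₀ = 1 ∧ i₀ ∉ J ∧ J.card ≤ k - 1 ∧ (∀ i ∈ J, ∃ l, b i = Pi.single l 1) ∧
      ∀ i, i ≠ i₀ → i ∉ J → b i ∈ X := by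
  classical
  obtain ⟨b₁, hb₁X, hspan, hli⟩ := exists_linearIndependent ℝ X
  have hli₁ : LinearIndepOn ℝ id b₁ := hli
  rw [← hspan] at h1
  have hli₂ : LinearIndepOn ℝ id (insert 1 b₁) := hli₁.id_insert h1
  obtain ⟨b, hbt, hsb, htb, hlib⟩ := exists_linearIndepOn_id_extension hli₂
    (subset_union_left (t := range fun l : Fin n => (Pi.single l 1 : Fin n → ℝ)))
  have htop : Submodule.span ℝ b = ⊤ := by
    rw [eq_top_iff, ← (Pi.basisFun ℝ (Fin n)).span_eq, Submodule.span_le]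
    rintro _ ⟨l, rfl⟩
    exact htb (Or.inr ⟨l, by simp⟩)
  let B : Module.Basis b ℝ (Fin n → ℝ) := Module.Basis.mk hlib (by simp [htop])
  have hfin : Finite b := Module.Finite.finite_basis B
  have : Fintype b := Fintype.ofFinite b
  have hcard : Fintype.card b = n := by
    rw [← Module.finrank_eq_card_basis B, Module.finrank_fin_fun]
  let e : Fin n ≃ b := (Fintype.equivFinOfCardEq hcard).symm
  have hmem1 : (1 : Fin n → ℝ) ∈ b := hsb (mem_insert _ _)
  have h1b : (1 : Fin n → ℝ) ∉ b₁ := fun h => h1 (Submodule.subset_span h)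
  refine ⟨fun i => e i, e.symm ⟨1, hmem1⟩,
    Finset.univ.filter fun i => (e i : Fin n → ℝ) ∉ insert 1 b₁, ?_, by simp, by simp, ?_, ?_, ?_⟩
  · exact LinearIndependent.comp hlib e e.injective
  · have hfinb₁ : (insert 1 b₁).Finite := (toFinite b).subset hsb
    have hb₁card : Module.finrank ℝ (Submodule.span ℝ X) = b₁.ncard := by
      rw [← hspan]
      have hb1f : Finite b₁ := (hfinb₁.subset (subset_insert _ _)).to_subtype
      have : Fintype b₁ := Fintype.ofFinite b₁
      rw [finrank_span_set_eq_card hli, Set.ncard_eq_toFinset_card']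
    have h2 : (Finset.univ.filter fun i => (e i : Fin n → ℝ) ∈ insert 1 b₁).card
        = b₁.ncard + 1 := by
      rw [← ncard_insert_of_notMem h1b (hfinb₁.subset (subset_insert _ _)), ← Set.ncard_coe_finset]
      have : (insert 1 b₁ : Set (Fin n → ℝ)) = (fun i => (e i : Fin n → ℝ)) ''
          ((Finset.univ.filter fun i => (e i : Fin n → ℝ) ∈ insert 1 b₁ : Finset (Fin n)) :
            Set (Fin n)) := by
        ext x
        constructor
        · intro hx
          exact ⟨e.symm ⟨x, hsb hx⟩, by simpa using hx, by simp⟩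
        · rintro ⟨i, hi, rfl⟩
          simpa using hi
      conv_rhs => rw [this]
      exact (ncard_image_of_injective _ (Subtype.val_injective.comp e.injective)).symm
    have h3 := Finset.card_filter_add_card_filter_not (s := (Finset.univ : Finset (Fin n)))
      (fun i => (e i : Fin n → ℝ) ∈ insert 1 b₁)
    rw [Finset.card_univ, Fintype.card_fin] at h3
    omega
  · intro i hi
    rw [Finset.mem_filter] at hi
    rcases hbt (e i).2 with h | ⟨l, hl⟩
    · exact absurd h hi.2
    · exact ⟨l, hl.symm⟩
  · intro i hi hiJ
    have h4 : (e i : Fin n → ℝ) ∈ insert 1 b₁ := by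
      by_contra h; exact hiJ (by simpa using h)
    rcases h4 with h | h
    · exact absurd (by rw [Equiv.eq_symm_apply]; exact Subtype.ext h) hi
    · exact hb₁X h

/-- If no weight is nonnegative and nonzero on `X`, the most negative value on `X` is comparable to
the largest absolute value. -/
lemma exists_gap {n : ℕ} {X : Finset (Fin n → ℝ)} (hX : X.Nonempty)
    (h : ∀ w : Fin n → ℝ, (∀ x ∈ X, 0 ≤ w ⬝ᵥ x) → ∀ x ∈ X, w ⬝ᵥ x = 0) :
    ∃ ε : ℝ, 0 < ε ∧ ∀ w : Fin n → ℝ, ∃ x ∈ X, ∀ x' ∈ X, w ⬝ᵥ x ≤ -(ε * |w ⬝ᵥ x'|) := by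
  let A : (Fin n → ℝ) →ₗ[ℝ] (X → ℝ) := LinearMap.pi fun x => dotProductBilin ℝ ℝ (x : Fin n → ℝ)
  have hA : ∀ w x, A w x = w ⬝ᵥ (x : Fin n → ℝ) := fun w x => dotProduct_comm (x : Fin n → ℝ) w
  let g : (X → ℝ) → ℝ := fun v => ∑ x, max (-v x) 0
  have hg : Continuous g := by simp only [g]; fun_prop
  have hgpos : ∀ w, A w ≠ 0 → 0 < g (A w) := fun w hw => by
    by_contra! hcon
    have h1 := (Finset.sum_eq_zero_iff_of_nonneg fun x _ => le_max_right (-A w x) 0).1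
      (le_antisymm hcon (Finset.sum_nonneg fun x _ => le_max_right _ _))
    refine hw (funext fun x => ?_)
    rw [hA]
    refine h w (fun y hy => ?_) x x.2
    have := max_eq_right_iff.1 (h1 ⟨y, hy⟩ (Finset.mem_univ _))
    rw [hA] at this
    linarith
  have hcomp : IsCompact (Metric.sphere (0 : X → ℝ) 1 ∩ (LinearMap.range A : Set (X → ℝ))) :=
    (isCompact_sphere _ _).inter_right (Submodule.closed_of_finiteDimensional _)
  obtain ⟨δ, hδ, hδg⟩ : ∃ δ > 0, ∀ w, δ * ‖A w‖ ≤ g (A w) := by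
    have hscale : ∀ δ : ℝ, (∀ v ∈ Metric.sphere (0 : X → ℝ) 1 ∩ (LinearMap.range A : Set (X → ℝ)),
        δ ≤ g v) → ∀ w, δ * ‖A w‖ ≤ g (A w) := fun δ hδ w => by
      rcases eq_or_ne (A w) 0 with h0 | h0
      · rw [h0, norm_zero, mul_zero]
        exact Finset.sum_nonneg fun x _ => le_max_right _ _
      · have hn := norm_pos_iff.2 h0
        have h1 := hδ (‖A w‖⁻¹ • A w) ⟨by simp [norm_smul, hn.ne'], ⟨‖A w‖⁻¹ • w, by simp⟩⟩
        have h2 : g (‖A w‖⁻¹ • A w) = ‖A w‖⁻¹ * g (A w) := by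
          simp only [g, Finset.mul_sum]
          refine Finset.sum_congr rfl fun x _ => ?_
          rw [mul_max_of_nonneg _ _ (inv_nonneg.2 hn.le), Pi.smul_apply, smul_eq_mul]
          simp
        rw [h2, inv_mul_eq_div, le_div_iff₀ hn] at h1
        exact h1
    rcases (Metric.sphere (0 : X → ℝ) 1 ∩ (LinearMap.range A : Set (X → ℝ))).eq_empty_or_nonempty
      with h0 | h0
    · exact ⟨1, one_pos, hscale 1 (by simp [h0])⟩
    · obtain ⟨v, ⟨hv1, w, rfl⟩, hmin⟩ := hcomp.exists_isMinOn h0 hg.continuousOn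
      refine ⟨g (A w), hgpos w fun h => ?_, hscale _ fun v' hv' => hmin hv'⟩
      rw [h] at hv1
      simp at hv1
  have hcard : (0 : ℝ) < X.card := by exact_mod_cast hX.card_pos
  refine ⟨δ / X.card, by positivity, fun w => ?_⟩
  obtain ⟨x₀, hx₀⟩ := hX
  rcases eq_or_ne (A w) 0 with h0 | h0
  · have h1 : ∀ x ∈ X, w ⬝ᵥ x = 0 := fun x hx => by
      rw [← hA w ⟨x, hx⟩, h0]; rfl
    exact ⟨x₀, hx₀, fun x' hx' => by rw [h1 x₀ hx₀, h1 x' hx']; simp⟩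
  obtain ⟨x, -, hx⟩ : ∃ x ∈ (Finset.univ : Finset X), δ / X.card * ‖A w‖ ≤ max (-A w x) 0 := by
    refine Finset.exists_le_of_sum_le ⟨⟨x₀, hx₀⟩, Finset.mem_univ _⟩ ?_
    rw [Finset.sum_const, Finset.card_univ, Fintype.card_coe, nsmul_eq_mul]
    refine le_trans (le_of_eq ?_) (hδg w)
    field_simp
  have hpos : 0 < δ / X.card * ‖A w‖ := mul_pos (by positivity) (norm_pos_iff.2 h0)
  have hx' : δ / X.card * ‖A w‖ ≤ -A w x := (le_max_iff.1 hx).resolve_right (not_le.2 hpos)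
  refine ⟨x, x.2, fun x' hx'X => ?_⟩
  have h2 : |w ⬝ᵥ x'| ≤ ‖A w‖ := by
    rw [← hA w ⟨x', hx'X⟩]; exact norm_le_pi_norm (A w) _
  have h3 := mul_le_mul_of_nonneg_left h2 (by positivity : 0 ≤ δ / X.card)
  rw [hA] at hx'
  linarith

/-- Logarithmic coordinates in each orthant of the unit cube. -/
lemma lintegral_cube_le_sum_orthants {n : ℕ} (H : (Fin n → ℝ) → ENNReal) :
    ∫⁻ t in {t : Fin n → ℝ | (∀ i, t i ≠ 0) ∧ ‖t‖ ≤ 1}, H t ≤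
      ∑ ε : Fin n → Bool, ∫⁻ w in Set.Ici (0 : Fin n → ℝ),
        ENNReal.ofReal (Real.exp (-∑ i, w i)) *
          H (fun i => (bif ε i then 1 else -1) * Real.exp (-w i)) := by
  classical
  let σ : (Fin n → Bool) → Fin n → ℝ := fun ε i => bif ε i then 1 else -1
  have hσ : ∀ ε i, |σ ε i| = 1 := fun ε i => by
    simp only [σ]; cases ε i <;> simp
  let Ψ : (Fin n → Bool) → (Fin n → ℝ) → Fin n → ℝ := fun ε w i => σ ε i * Real.exp (-w i)
  have hcover : {t : Fin n → ℝ | (∀ i, t i ≠ 0) ∧ ‖t‖ ≤ 1} ⊆ ⋃ ε, Ψ ε '' Set.Ici 0 := by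
    rintro t ⟨ht, ht1⟩
    refine mem_iUnion.2 ⟨fun i => decide (0 < t i), fun i => -Real.log |t i|, fun i => ?_, ?_⟩
    · have : |t i| ≤ 1 := (norm_le_pi_norm t i).trans ht1
      simpa using Real.log_nonpos (abs_nonneg _) this
    · funext i
      simp only [Ψ, σ, neg_neg]
      rw [Real.exp_log (abs_pos.2 (ht i))]
      by_cases h : 0 < t i
      · simp [h, abs_of_pos h]
      · simp [h, abs_of_nonpos (not_lt.1 h)]
  refine (lintegral_mono_set hcover).trans ((lintegral_iUnion_le _ _).trans ?_)
  rw [tsum_fintype]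
  refine Finset.sum_le_sum fun ε _ => le_of_eq ?_
  have hder : ∀ w ∈ Set.Ici (0 : Fin n → ℝ), HasFDerivWithinAt (Ψ ε)
      (LinearMap.toContinuousLinearMap (Matrix.toLin' (Matrix.diagonal fun i =>
        σ ε i * -Real.exp (-w i)))) (Set.Ici 0) w := by
    intro w _
    refine HasFDerivAt.hasFDerivWithinAt (hasFDerivAt_pi'.2 fun i => ?_)
    have h1 : HasDerivAt (fun x : ℝ => σ ε i * Real.exp (-x)) (σ ε i * -Real.exp (-w i)) (w i) := by
      simpa using ((hasDerivAt_neg (w i)).exp).const_mul (σ ε i)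
    have h2 := h1.comp_hasFDerivAt w
      ((ContinuousLinearMap.proj (R := ℝ) (φ := fun _ : Fin n => ℝ) i).hasFDerivAt (x := w))
    refine h2.congr_fderiv (ContinuousLinearMap.ext fun v => ?_)
    simp [Matrix.mulVec_diagonal]
  have hinj : InjOn (Ψ ε) (Set.Ici 0) := by
    intro w _ w' _ h
    funext i
    have h1 := congrFun h i
    have h0 : σ ε i ≠ 0 := fun h => by have := hσ ε i; simp [h] at this
    have h2 := Real.exp_injective (mul_left_cancel₀ h0 h1)
    linarith
  rw [lintegral_image_eq_lintegral_abs_det_fderiv_mul volume measurableSet_Ici hder hinj]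
  congr 1
  funext w
  congr 2
  change |LinearMap.det (Matrix.toLin' (Matrix.diagonal fun i => σ ε i * -Real.exp (-w i)))| = _
  rw [LinearMap.det_toLin', Matrix.det_diagonal, Finset.abs_prod, ← Finset.sum_neg_distrib,
    Real.exp_sum]
  refine Finset.prod_congr rfl fun i _ => ?_
  rw [abs_mul, hσ, one_mul, abs_neg, Real.abs_exp]

lemma abs_monomial_orthant {n : ℕ} (ε : Fin n → Bool) (w : Fin n → ℝ) (s : Fin n → ℕ) :
    |∏ i, ((bif ε i then 1 else -1) * Real.exp (-w i)) ^ s i| =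
      Real.exp (-(w ⬝ᵥ exponentPoint s)) := by
  rw [monomial_sign_mul_exp (fun i => bif ε i then 1 else -1) w s, abs_mul, Real.abs_exp,
    Finset.abs_prod, Finset.prod_eq_one, one_mul]
  intro i _
  cases ε i <;> simp

lemma le_exp_of_le_pow {d Y q E h : ℝ} {N : ℕ} (hd : 0 < d) (hN : 2 / d ≤ N)
    (hq : 0 ≤ q) (hE : E = Y + q) (h1 : h ≤ 1) (hL : h ≤ Real.exp (-E) ^ N) :
    h ≤ Real.exp (-(Y / d) - |Y| / (2 * d) - q / (2 * d)) := by
  rw [← Real.exp_nat_mul] at hL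
  have hθ : ∀ θ : ℝ, 0 ≤ θ → θ ≤ N → h ≤ Real.exp (-(θ * E)) := fun θ h0 hθN => by
    rcases le_total 0 E with hE0 | hE0
    · refine hL.trans (Real.exp_le_exp.2 ?_)
      nlinarith
    · refine h1.trans (Real.one_le_exp ?_)
      nlinarith
  have hi : 0 < 1 / d := by positivity
  have hN' : 2 * (1 / d) ≤ N := by rw [mul_one_div]; exact hN
  have hsimp : -(Y / d) - |Y| / (2 * d) - q / (2 * d)
      = -(1 / d * Y) - 1 / d * |Y| / 2 - 1 / d * q / 2 := by field_simp
  rw [hsimp]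
  have hqi : 0 ≤ 1 / d * q := by positivity
  rcases le_total 0 Y with hY | hY
  · refine (hθ (3 / 2 * (1 / d)) (by positivity) (by linarith)).trans (Real.exp_le_exp.2 ?_)
    rw [abs_of_nonneg hY, hE]
    linarith
  · refine (hθ (1 / 2 * (1 / d)) (by positivity) (by linarith)).trans (Real.exp_le_exp.2 ?_)
    rw [abs_of_nonpos hY, hE]
    linarith

/-- The volume estimate: integrals of functions dominated by powers of the size of the monomials. -/
lemma exists_lintegral_cube_le {n k N : ℕ} {S : Finset (Fin n → ℕ)} {d : ℝ} (hd : 0 < d)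
    (hN : 2 / d ≤ N) {X : Finset (Fin n → ℝ)} (hX : X.Nonempty)
    (hXS : ∀ x ∈ X, ∃ s ∈ S, x = exponentPoint s - fun _ => d)
    (hgap : ∀ w : Fin n → ℝ, (∀ x ∈ X, 0 ≤ w ⬝ᵥ x) → ∀ x ∈ X, w ⬝ᵥ x = 0)
    (h1 : (1 : Fin n → ℝ) ∉ Submodule.span ℝ (X : Set (Fin n → ℝ)))
    (hk : n ≤ Module.finrank ℝ (Submodule.span ℝ (X : Set (Fin n → ℝ))) + k) :
    ∃ C : ℝ, 0 ≤ C ∧ ∀ r : ℝ, 2 ≤ r → ∀ H : (Fin n → ℝ) → ℝ,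
      (∀ t, (∀ i, t i ≠ 0) → ‖t‖ ≤ 1 → H t ≤ 1 ∧ H t ≤ ((r * monomialSize S t)⁻¹) ^ N) →
      ∫⁻ t in {t : Fin n → ℝ | (∀ i, t i ≠ 0) ∧ ‖t‖ ≤ 1}, ENNReal.ofReal (H t) ≤
        ENNReal.ofReal (C * r ^ (-(1 / d)) * Real.log r ^ (k - 1)) := by
  classical
  obtain ⟨b, i₀, J, hb, hbi₀, hi₀J, hJk, hbJ, hbX⟩ := exists_adapted_basis h1 hk
  obtain ⟨ε, hε, hgapε⟩ := exists_gap hX hgap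
  obtain ⟨Cb, hCb0, hCb⟩ := exists_lintegral_prod_exp_le hb
  have hn : (0 : ℝ) < n := by exact_mod_cast i₀.pos
  have hlog2 : 0 < Real.log 2 := Real.log_pos one_lt_two
  let c : Fin n → ℝ := fun i => if i = i₀ then 1 / 4 else if i ∈ J then 1 / (4 * n)
    else ε / (2 * d * n)
  have hc : ∀ i, 0 < c i := fun i => by
    simp only [c]; split_ifs <;> positivity
  refine ⟨2 ^ n * (Real.exp (Real.log 2 / (4 * d)) *
    (Cb * ((∏ i, (c i)⁻¹) * ((Real.log 2)⁻¹) ^ (k - 1)))), ?_, fun r hr H hH => ?_⟩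
  · have : 0 ≤ ∏ i, (c i)⁻¹ := Finset.prod_nonneg fun i _ => (inv_pos.2 (hc i)).le
    positivity
  have hr0 : 0 < r := by linarith
  set L := Real.log r with hLdef
  have hL2 : Real.log 2 ≤ L := Real.log_le_log two_pos hr
  have hL : 0 < L := hlog2.trans_le hL2
  let Λ : ℝ := L / Real.log 2
  have hΛ : 1 ≤ Λ := (one_le_div hlog2).2 hL2
  let κ : Fin n → ℝ := fun i => c i / (if i ∈ J then Λ else 1)
  have hκ : ∀ i, 0 < κ i := fun i => by
    refine div_pos (hc i) ?_
    split_ifs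
    · linarith
    · exact one_pos
  let z : Fin n → ℝ := fun i => if i = i₀ then L / d else 0
  have hpt : ∀ (e : Fin n → Bool), ∀ w ∈ Set.Ici (0 : Fin n → ℝ),
      Real.exp (-∑ i, w i) * H (fun i => (bif e i then 1 else -1) * Real.exp (-w i)) ≤
        Real.exp (Real.log 2 / (4 * d)) * Real.exp (-(L / d)) *
          ∏ i, Real.exp (-(κ i * |b i ⬝ᵥ w - z i|)) := by
    intro e w hw
    have hw0 : ∀ i, 0 ≤ w i := hw
    set t : Fin n → ℝ := fun i => (bif e i then 1 else -1) * Real.exp (-w i) with ht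
    have ht0 : ∀ i, t i ≠ 0 := fun i => by
      refine mul_ne_zero ?_ (Real.exp_ne_zero _)
      cases e i <;> simp
    have ht1 : ‖t‖ ≤ 1 := (pi_norm_le_iff_of_nonneg zero_le_one).2 fun i => by
      have h3 : ‖(bif e i then (1 : ℝ) else -1)‖ = 1 := by cases e i <;> simp
      rw [ht, norm_mul, h3, one_mul, Real.norm_eq_abs, Real.abs_exp, Real.exp_le_one_iff]
      linarith [hw0 i]
    set σ := ∑ i, w i with hσ
    have hσ0 : 0 ≤ σ := Finset.sum_nonneg fun i _ => hw0 i
    obtain ⟨x, hxX, hx⟩ := hgapε w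
    obtain ⟨s, hs, rfl⟩ := hXS x hxX
    set q := -(w ⬝ᵥ (exponentPoint s - fun _ => d)) with hq
    have hqx : ∀ x' ∈ X, ε * |w ⬝ᵥ x'| ≤ q := fun x' hx' => by
      have := hx x' hx'; rw [hq]; linarith
    have hq0 : 0 ≤ q := le_trans (by positivity) (hqx _ hxX)
    have hwD : w ⬝ᵥ (fun _ : Fin n => d) = d * σ := by
      simp only [dotProduct, hσ, Finset.mul_sum, mul_comm]
    have hM : Real.exp (-(d * σ) + q) ≤ monomialSize S t := by
      have h3 : |∏ i, t i ^ s i| ≤ monomialSize S t :=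
        Finset.single_le_sum (f := fun s : Fin n → ℕ => |∏ i, t i ^ s i|)
          (fun _ _ => abs_nonneg _) hs
      refine le_trans (le_of_eq ?_) h3
      rw [ht, abs_monomial_orthant]
      congr 1
      rw [hq, dotProduct_sub, hwD]; ring
    obtain ⟨hH1, hH2⟩ := hH t ht0 ht1
    set Y := L - d * σ with hY
    have hrM : Real.exp (Y + q) ≤ r * monomialSize S t := by
      rw [hY, show L - d * σ + q = L + (-(d * σ) + q) by ring, Real.exp_add, hLdef,
        Real.exp_log hr0]
      exact mul_le_mul_of_nonneg_left hM hr0.le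
    have hH3 : H t ≤ Real.exp (-(Y + q)) ^ N := by
      refine hH2.trans (pow_le_pow_left₀ ?_ ?_ N)
      · exact inv_nonneg.2 ((Real.exp_pos _).le.trans hrM)
      · rw [Real.exp_neg]; exact inv_anti₀ (Real.exp_pos _) hrM
    have hH4 := le_exp_of_le_pow hd hN hq0 rfl hH1 hH3
    have hsum : ∑ i, κ i * |b i ⬝ᵥ w - z i| ≤
        |Y| / (2 * d) + q / (2 * d) + Real.log 2 / (4 * d) := by
      have hterm : ∀ i, κ i * |b i ⬝ᵥ w - z i| ≤ (if i = i₀ then |Y| / (4 * d) else 0) +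
          Real.log 2 / (4 * n) * (σ / L) + q / (2 * d * n) := by
        intro i
        have hA : 0 ≤ Real.log 2 / (4 * n) * (σ / L) := by positivity
        have hB : 0 ≤ q / (2 * d * n) := by positivity
        by_cases hi : i = i₀
        · have hb1 : b i ⬝ᵥ w = σ := by
            rw [hi, hbi₀]; simp [dotProduct, hσ]
          have : |σ - L / d| = |Y| / d := by
            rw [hY, ← abs_of_pos hd, ← abs_div, abs_of_pos hd, ← abs_neg]
            congr 1; field_simp; ring
          have hκi : κ i = 1 / 4 := by simp [κ, c, hi, hi₀J]
          rw [hb1, hκi]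
          simp only [z, if_pos hi]
          rw [this]
          have : 1 / 4 * (|Y| / d) = |Y| / (4 * d) := by field_simp
          linarith
        · simp only [z, if_neg hi, sub_zero, zero_add]
          by_cases hiJ : i ∈ J
          · obtain ⟨l, hl⟩ := hbJ i hiJ
            have hκi : κ i = Real.log 2 / (4 * n) / L := by
              simp only [κ, c, if_neg hi, if_pos hiJ, Λ]; field_simp
            rw [hl, single_dotProduct, one_mul, abs_of_nonneg (hw0 l), hκi]
            have : w l ≤ σ := Finset.single_le_sum (f := w) (fun i _ => hw0 i) (Finset.mem_univ l)
            have h5 : Real.log 2 / (4 * n) / L * w l ≤ Real.log 2 / (4 * n) / L * σ := by gcongr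
            have h6 : Real.log 2 / (4 * n) / L * σ = Real.log 2 / (4 * n) * (σ / L) := by ring
            linarith
          · have h5 := hqx _ (hbX i hi hiJ)
            have hκi : κ i = ε / (2 * d * n) := by
              simp only [κ, c, if_neg hi, if_neg hiJ, div_one]
            rw [hκi, dotProduct_comm, div_mul_eq_mul_div]
            have : ε * |w ⬝ᵥ b i| / (2 * d * n) ≤ q / (2 * d * n) := by gcongr
            linarith
      refine (Finset.sum_le_sum fun i _ => hterm i).trans ?_
      rw [Finset.sum_add_distrib, Finset.sum_add_distrib, Finset.sum_ite_eq' Finset.univ i₀,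
        if_pos (Finset.mem_univ _), Finset.sum_const, Finset.sum_const, Finset.card_univ,
        Fintype.card_fin, nsmul_eq_mul, nsmul_eq_mul]
      have h7 : (n : ℝ) * (q / (2 * d * n)) = q / (2 * d) := by field_simp
      have h8 : (n : ℝ) * (Real.log 2 / (4 * n) * (σ / L)) = Real.log 2 / (4 * d) * (d * σ / L) := by
        field_simp
      have h9 : d * σ ≤ L + |Y| := by
        have := neg_abs_le Y; rw [hY] at this ⊢; linarith
      have h10 : Real.log 2 / (4 * d) * (d * σ / L) ≤
          Real.log 2 / (4 * d) + |Y| / (4 * d) := by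
        calc Real.log 2 / (4 * d) * (d * σ / L) ≤ Real.log 2 / (4 * d) * ((L + |Y|) / L) := by gcongr
          _ = Real.log 2 / (4 * d) + (Real.log 2 / L) * (|Y| / (4 * d)) := by field_simp
          _ ≤ Real.log 2 / (4 * d) + 1 * (|Y| / (4 * d)) := by
            gcongr; exact (div_le_one hL).2 hL2
          _ = _ := by rw [one_mul]
      have h11 : |Y| / (4 * d) + |Y| / (4 * d) = |Y| / (2 * d) := by field_simp; ring
      rw [h7, h8]; linarith
    calc Real.exp (-σ) * H t
        ≤ Real.exp (-σ) * Real.exp (-(Y / d) - |Y| / (2 * d) - q / (2 * d)) := by gcongr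
      _ ≤ Real.exp (Real.log 2 / (4 * d)) * Real.exp (-(L / d)) *
          Real.exp (∑ i, -(κ i * |b i ⬝ᵥ w - z i|)) := by
        rw [← Real.exp_add, ← Real.exp_add, ← Real.exp_add, Real.exp_le_exp,
          Finset.sum_neg_distrib]
        have : Y / d = L / d - σ := by rw [hY]; field_simp
        linarith
      _ = _ := by rw [Real.exp_sum]
  have hκprod : ∏ i, (κ i)⁻¹ ≤ (∏ i, (c i)⁻¹) * Λ ^ (k - 1) := by
    have h3 : ∏ i, (κ i)⁻¹ = (∏ i, (c i)⁻¹) * Λ ^ J.card := by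
      have h4 : ∀ i, (κ i)⁻¹ = (c i)⁻¹ * if i ∈ J then Λ else 1 := fun i => by
        simp only [κ]; rw [inv_div, div_eq_inv_mul]
      simp only [h4, Finset.prod_mul_distrib]
      congr 1
      rw [Finset.prod_ite_mem, Finset.univ_inter, Finset.prod_const]
    rw [h3]
    have : 0 ≤ ∏ i, (c i)⁻¹ := Finset.prod_nonneg fun i _ => (inv_pos.2 (hc i)).le
    exact mul_le_mul_of_nonneg_left (pow_le_pow_right₀ hΛ hJk) this
  have horth : ∀ e : Fin n → Bool, ∫⁻ w in Set.Ici (0 : Fin n → ℝ),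
      ENNReal.ofReal (Real.exp (-∑ i, w i)) *
        ENNReal.ofReal (H (fun i => (bif e i then 1 else -1) * Real.exp (-w i))) ≤
      ENNReal.ofReal (Real.exp (Real.log 2 / (4 * d)) * Real.exp (-(L / d)) *
        (Cb * ((∏ i, (c i)⁻¹) * Λ ^ (k - 1)))) := by
    intro e
    calc _ ≤ ∫⁻ w in Set.Ici (0 : Fin n → ℝ),
          ENNReal.ofReal (Real.exp (Real.log 2 / (4 * d)) * Real.exp (-(L / d))) *
          ENNReal.ofReal (∏ i, Real.exp (-(κ i * |b i ⬝ᵥ w - z i|))) := by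
          refine setLIntegral_mono' measurableSet_Ici fun w hw => ?_
          rw [← ENNReal.ofReal_mul (Real.exp_pos _).le, ← ENNReal.ofReal_mul (by positivity)]
          exact ENNReal.ofReal_le_ofReal (hpt e w hw)
      _ ≤ ∫⁻ w : Fin n → ℝ,
          ENNReal.ofReal (Real.exp (Real.log 2 / (4 * d)) * Real.exp (-(L / d))) *
          ENNReal.ofReal (∏ i, Real.exp (-(κ i * |b i ⬝ᵥ w - z i|))) :=
          setLIntegral_le_lintegral _ _
      _ = ENNReal.ofReal (Real.exp (Real.log 2 / (4 * d)) * Real.exp (-(L / d))) *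
          ∫⁻ w : Fin n → ℝ, ENNReal.ofReal (∏ i, Real.exp (-(κ i * |b i ⬝ᵥ w - z i|))) :=
          lintegral_const_mul' _ _ ENNReal.ofReal_ne_top
      _ ≤ ENNReal.ofReal (Real.exp (Real.log 2 / (4 * d)) * Real.exp (-(L / d))) *
          ENNReal.ofReal (Cb * ∏ i, (κ i)⁻¹) := by gcongr; exact hCb κ z hκ
      _ ≤ _ := by
          rw [← ENNReal.ofReal_mul (by positivity)]
          refine ENNReal.ofReal_le_ofReal ?_
          gcongr
  refine (lintegral_cube_le_sum_orthants _).trans ((Finset.sum_le_sum fun e _ => horth e).trans ?_)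
  rw [Finset.sum_const, Finset.card_univ, Fintype.card_fun, Fintype.card_bool, Fintype.card_fin,
    nsmul_eq_mul, ← ENNReal.ofReal_natCast, ← ENNReal.ofReal_mul (by positivity)]
  refine ENNReal.ofReal_le_ofReal (le_of_eq ?_)
  rw [Real.rpow_def_of_pos hr0, ← hLdef, show L * -(1 / d) = -(L / d) by ring]
  simp only [Λ, div_eq_mul_inv L (Real.log 2), mul_pow]
  push_cast
  ring

section

variable {n : ℕ} {f : EuclideanSpace ℝ (Fin n) → ℝ} {S : Finset (Fin n → ℕ)}

lemma taylorCoeff_zero : taylorCoeff f 0 = f 0 := by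
  have h : ∀ l : List (Fin n), l.foldr (fun i g => (partialDeriv i)^[(0 : Fin n → ℕ) i] g) f = f :=
    fun l => by
      induction l with
      | nil => rfl
      | cons i l ih => rw [List.foldr_cons, ih]; rfl
  rw [taylorCoeff, mixedDeriv, h]
  simp

lemma newtonDistance_pos_of_mem
    (hS : ∀ s, s ∈ S ↔ Minimal (fun α => taylorCoeff f α ≠ 0) s) (hf0 : f 0 = 0) {d : ℝ}
    (hd : (fun _ : Fin n => d) ∈ newtonPolyhedron f) : 0 < d ∧ 0 < n := by
  have h1 : (1 : ℝ) ≤ 1 ⬝ᵥ fun _ : Fin n => d := by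
    refine le_dotProduct_of_mem_newtonPolyhedron hS (fun _ => zero_le_one) (fun s hs => ?_) hd
    have hs0 : s ≠ 0 := fun h => ((hS s).1 hs).1 (by rw [h, taylorCoeff_zero, hf0])
    obtain ⟨i, hi⟩ := Function.ne_iff.1 hs0
    have h2 : (1 : ℝ) ≤ s i := by exact_mod_cast Nat.one_le_iff_ne_zero.2 hi
    simp only [dotProduct, exponentPoint, one_mul]
    exact h2.trans (Finset.single_le_sum (f := fun i => (s i : ℝ)) (fun _ _ => Nat.cast_nonneg _)
      (Finset.mem_univ i))
  simp only [dotProduct, Pi.one_apply, one_mul, Finset.sum_const, Finset.card_univ,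
    Fintype.card_fin, nsmul_eq_mul] at h1
  have hn : (0 : ℝ) ≤ n := Nat.cast_nonneg _
  constructor
  · by_contra! h; nlinarith
  · rcases Nat.eq_zero_or_pos n with h | h
    · rw [h] at h1; norm_num at h1
    · exact h

/-- The directions from `(d, …, d)` to the exponents on the principal face, and their properties. -/
lemma exists_principal_directions
    (hS : ∀ s, s ∈ S ↔ Minimal (fun α => taylorCoeff f α ≠ 0) s) {γ : Set (Fin n → ℝ)}
    (hγ : IsPrincipalFace f γ) (hn : 0 < n) :
    ∃ X : Finset (Fin n → ℝ), X.Nonempty ∧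
      (∀ x ∈ X, ∃ s ∈ S, x = exponentPoint s - fun _ => newtonDistance f) ∧
      (∀ w : Fin n → ℝ, (∀ x ∈ X, 0 ≤ w ⬝ᵥ x) → ∀ x ∈ X, w ⬝ᵥ x = 0) ∧
      (1 : Fin n → ℝ) ∉ Submodule.span ℝ (X : Set (Fin n → ℝ)) ∧
      faceDim γ ≤ Module.finrank ℝ (Submodule.span ℝ (X : Set (Fin n → ℝ))) := by
  classical
  set D : Fin n → ℝ := fun _ => newtonDistance f with hDdef
  obtain ⟨hface, hDγ, hmin⟩ := hγ
  obtain ⟨u, hu, hle, hD, rfl⟩ := exists_weight_of_isCompactFace hface hDγ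
  have hm : ∀ s ∈ S, u ⬝ᵥ D ≤ u ⬝ᵥ exponentPoint s := fun s hs =>
    hle _ (exponentPoint_mem_newtonPolyhedron ((hS s).1 hs).1)
  let X := (S.filter fun s => u ⬝ᵥ exponentPoint s = u ⬝ᵥ D).image fun s => exponentPoint s - D
  have hXmem : ∀ x, x ∈ X ↔ ∃ s ∈ S, u ⬝ᵥ exponentPoint s = u ⬝ᵥ D ∧ exponentPoint s - D = x :=
    fun x => by simp only [X, Finset.mem_image, Finset.mem_filter, and_assoc]
  have hconst : ∀ w : Fin n → ℝ, (∀ x ∈ X, 0 ≤ w ⬝ᵥ x) →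
      ∀ x ∈ newtonPolyhedron f, u ⬝ᵥ x = u ⬝ᵥ D → w ⬝ᵥ x = w ⬝ᵥ D := fun w hw x hx hxD => by
    refine dotProduct_eq_of_minimal_face hS hu hD hm hmin (fun s hs hsD => ?_) hx hxD
    have := hw _ ((hXmem _).2 ⟨s, hs, hsD, rfl⟩)
    rw [dotProduct_sub] at this
    linarith
  refine ⟨X, ?_, fun x hx => ?_, fun w hw x hx => ?_, fun h => ?_, ?_⟩
  · have hSne : S.Nonempty := by
      by_contra hcon
      rw [Finset.not_nonempty_iff_eq_empty] at hcon
      have := le_dotProduct_of_mem_newtonPolyhedron hS (fun i => (hu i).le) (m := u ⬝ᵥ D + 1)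
        (by simp [hcon]) hD
      linarith
    obtain ⟨s, hs, hsmin⟩ := S.exists_min_image (fun s => u ⬝ᵥ exponentPoint s) hSne
    have := le_dotProduct_of_mem_newtonPolyhedron hS (fun i => (hu i).le) hsmin hD
    exact ⟨_, (hXmem _).2 ⟨s, hs, le_antisymm this (hm s hs), rfl⟩⟩
  · obtain ⟨s, hs, -, rfl⟩ := (hXmem x).1 hx
    exact ⟨s, hs, rfl⟩
  · obtain ⟨s, hs, hsD, rfl⟩ := (hXmem x).1 hx
    rw [dotProduct_sub, hconst w hw _ (exponentPoint_mem_newtonPolyhedron ((hS s).1 hs).1) hsD,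
      sub_self]
  · have hker : Submodule.span ℝ (X : Set (Fin n → ℝ)) ≤
        LinearMap.ker (dotProductBilin ℝ ℝ u : (Fin n → ℝ) →ₗ[ℝ] ℝ) := by
      rw [Submodule.span_le]
      intro x hx
      obtain ⟨s, -, hsD, rfl⟩ := (hXmem x).1 hx
      change u ⬝ᵥ (exponentPoint s - D) = 0
      rw [dotProduct_sub, hsD, sub_self]
    have h0 : u ⬝ᵥ (1 : Fin n → ℝ) = 0 := hker h
    have hpos : 0 < u ⬝ᵥ (1 : Fin n → ℝ) := by
      simp only [dotProduct, Pi.one_apply, mul_one]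
      exact Finset.sum_pos (fun i _ => hu i) ⟨⟨0, hn⟩, Finset.mem_univ _⟩
    exact hpos.ne' h0
  · refine Submodule.finrank_mono ?_
    have hsub : ∀ x ∈ {x ∈ newtonPolyhedron f | u ⬝ᵥ x = u ⬝ᵥ D},
        x - D ∈ Submodule.span ℝ (X : Set (Fin n → ℝ)) := by
      rintro x ⟨hx, hxD⟩
      by_contra hcon
      obtain ⟨φ, hφ, hker⟩ := Submodule.exists_le_ker_of_notMem hcon
      let w : Fin n → ℝ := fun i => φ (Pi.single i 1)
      have hw : ∀ v, w ⬝ᵥ v = φ v := fun v => by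
        conv_rhs => rw [pi_eq_sum_univ' v]
        simp [w, dotProduct, mul_comm]
      have h1 := hconst w (fun v hv => by
        rw [hw]; exact (show φ v = 0 from hker (Submodule.subset_span hv)).ge) x hx hxD
      rw [hw, hw] at h1
      exact hφ (by rw [map_sub, h1, sub_self])
    rw [vectorSpan_def, Submodule.span_le]
    rintro _ ⟨y, hy, z, hz, rfl⟩
    have := Submodule.sub_mem _ (hsub y hy) (hsub z hz)
    rwa [sub_sub_sub_cancel_right] at this

lemma ae_forall_ne_zero : ∀ᵐ t : Fin n → ℝ, ∀ i, t i ≠ 0 :=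
  eventually_all.2 fun i => Measure.ae_eval_ne (fun _ : Fin n => (volume : Measure ℝ)) i 0

lemma measurableSet_punctured_cube :
    MeasurableSet {t : Fin n → ℝ | (∀ i, t i ≠ 0) ∧ ‖t‖ ≤ 1} := by
  have : {t : Fin n → ℝ | (∀ i, t i ≠ 0) ∧ ‖t‖ ≤ 1} =
      (⋂ i, {t | t i = 0}ᶜ) ∩ Metric.closedBall 0 1 := by ext; simp
  rw [this]
  exact (MeasurableSet.iInter fun i => (measurableSet_eq_fun (measurable_pi_apply i)
    measurable_const).compl).inter measurableSet_closedBall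

lemma norm_integral_le_of_cube {J : (Fin n → ℝ) → ℂ} {B C : ℝ} (hB : 0 < B) (hC : 0 ≤ C)
    (hJ : ∀ t, 1 < ‖t‖ → J t = 0)
    (h : ∫⁻ t in {t : Fin n → ℝ | (∀ i, t i ≠ 0) ∧ ‖t‖ ≤ 1}, ENNReal.ofReal (‖J t‖ / B) ≤
      ENNReal.ofReal C) : ‖∫ t, J t‖ ≤ B * C := by
  set U := {t : Fin n → ℝ | (∀ i, t i ≠ 0) ∧ ‖t‖ ≤ 1}
  have h1 : ∫⁻ t, ‖J t‖ₑ ≤ ∫⁻ t in U, ENNReal.ofReal B * ENNReal.ofReal (‖J t‖ / B) := by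
    rw [← lintegral_indicator measurableSet_punctured_cube]
    refine lintegral_mono_ae ?_
    filter_upwards [ae_forall_ne_zero] with t ht
    by_cases ht1 : ‖t‖ ≤ 1
    · rw [indicator_of_mem (show t ∈ U from ⟨ht, ht1⟩), ← ENNReal.ofReal_mul hB.le,
        mul_div_cancel₀ _ hB.ne', ofReal_norm]
    · rw [hJ t (not_le.1 ht1)]; simp
  rw [lintegral_const_mul' _ _ ENNReal.ofReal_ne_top] at h1
  have h2 : ‖∫ t, J t‖ₑ ≤ ENNReal.ofReal (B * C) := by
    refine (enorm_integral_le_lintegral_enorm _).trans (h1.trans ?_)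
    rw [ENNReal.ofReal_mul hB.le]
    gcongr
  rw [← ofReal_norm] at h2
  exact (ENNReal.ofReal_le_ofReal_iff (by positivity)).1 h2

lemma oscIntegral_eq_integral_pi (φ : EuclideanSpace ℝ (Fin n) → ℂ) (r : ℝ) :
    oscIntegral f φ r = ∫ x : Fin n → ℝ,
      Complex.exp (Complex.I * r * f (WithLp.toLp 2 x)) * φ (WithLp.toLp 2 x) := by
  rw [oscIntegral, ← (PiLp.volume_preserving_toLp (Fin n)).integral_comp
    (MeasurableEquiv.toLp 2 _).measurableEmbedding]

/-- The oscillatory integral of a nondegenerate phase is bounded, up to a constant, by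
`t ^ (-1 / d) (log t) ^ (k - 1)`. -/
lemma exists_norm_oscIntegral_le (hf : RealAnalyticNearZero f) (hnd : IsNondegenerate f)
    (hf0 : f 0 = 0) {γ : Set (Fin n → ℝ)} (hγ : IsPrincipalFace f γ) {k : ℕ}
    (hk : faceDim γ + k = n) :
    ∃ r : ℝ, 0 < r ∧ ∀ φ : EuclideanSpace ℝ (Fin n) → ℂ, ContDiff ℝ ∞ φ →
      tsupport φ ⊆ Metric.ball (0 : EuclideanSpace ℝ (Fin n)) r →
      ∃ C : ℝ, 0 ≤ C ∧ ∀ t : ℝ, 2 ≤ t →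
        ‖oscIntegral f φ t‖ ≤ C * t ^ (-(1 / newtonDistance f)) * Real.log t ^ (k - 1) := by
  set d := newtonDistance f with hd_def
  set S := (finite_setOf_minimal fun α => taylorCoeff f α ≠ 0).toFinset with hSdef
  have hS : ∀ s, s ∈ S ↔ Minimal (fun α => taylorCoeff f α ≠ 0) s := fun s => by simp [hSdef]
  have hDN : (fun _ : Fin n => d) ∈ newtonPolyhedron f := by
    obtain ⟨l, hl⟩ := hγ.1.2.1 hγ.1.1
    have := hγ.2.1
    rw [hl] at this
    exact this.1
  obtain ⟨hd, hn⟩ := newtonDistance_pos_of_mem hS hf0 hDN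
  obtain ⟨X, hXne, hXS, hgap, h1X, hdim⟩ := exists_principal_directions hS hγ hn
  have hSne : S.Nonempty := by
    obtain ⟨x, hx⟩ := hXne
    obtain ⟨s, hs, -⟩ := hXS x hx
    exact ⟨s, hs⟩
  have hf' : ∀ᶠ x in 𝓝 (0 : Fin n → ℝ),
      HasSum (fun α => taylorCoeff f α * ∏ i, x i ^ α i) (f (WithLp.toLp 2 x)) :=
    ((PiLp.continuous_toLp 2 fun _ : Fin n => ℝ).tendsto 0).eventually hf
  obtain ⟨G, hG, hG0, hfG⟩ := exists_monomial_decomposition _ _ hf' S hS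
  obtain ⟨r₀, hr₀, hball⟩ := Metric.eventually_nhds_iff.1 hfG
  let K : Set (Fin n → ℝ) := Metric.closedBall 1 (1 / 2)
  have hK : IsCompact K := isCompact_closedBall _ _
  have hKpos : ∀ y ∈ K, ∀ i, 1 / 2 ≤ y i := fun y hy i => by
    have h1 := (norm_le_pi_norm (y - 1) i).trans (mem_closedBall_iff_norm.1 hy)
    rw [Pi.sub_apply, Pi.one_apply, Real.norm_eq_abs, abs_le] at h1
    linarith
  let χ : ContDiffBump (1 : Fin n → ℝ) := ⟨1 / 4, 1 / 2, by norm_num, by norm_num⟩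
  have hχK : ∀ y ∉ K, χ y = 0 := fun y hy => χ.zero_of_le_dist (le_of_lt (not_le.1 hy))
  have hχ₁ : ContDiff ℝ ∞ fun y => χ y * ∏ i, y i :=
    χ.contDiff.mul (contDiff_prod fun i _ => by fun_prop)
  obtain ⟨ρ, hρ, hρ1, hgrad⟩ := exists_radius_fderiv_ne_zero hnd hS hSne hG hG0 hK
    fun y hy i => ((by norm_num : (0 : ℝ) < 1 / 2).trans_le (hKpos y hy i)).ne'
  obtain ⟨N, hN⟩ := exists_nat_ge (2 / d)
  obtain ⟨C₁, hC₁, hvol⟩ := exists_lintegral_cube_le (k := k) hd hN hXne hXS hgap h1X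
    (hk.symm.le.trans (Nat.add_le_add_right hdim k))
  refine ⟨min (ρ / 2) r₀, lt_min (by positivity) hr₀, fun φ hφ hsupp => ?_⟩
  let φ' : (Fin n → ℝ) → ℂ := fun x => φ (WithLp.toLp 2 x)
  have hφ' : ContDiff ℝ ∞ φ' := hφ.comp (PiLp.contDiff_toLp)
  have hφsupp : ∀ x, φ' x ≠ 0 → ‖x‖ < min (ρ / 2) r₀ := fun x hx => by
    have h1 : ‖WithLp.toLp 2 x‖ < min (ρ / 2) r₀ :=
      mem_ball_zero_iff.1 (hsupp (subset_tsupport φ hx))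
    exact (pi_norm_lt_iff ((norm_nonneg _).trans_lt h1)).2 fun i =>
      (PiLp.norm_apply_le (WithLp.toLp 2 x) i).trans_lt h1
  let Q : (Fin n → ℝ) → ℝ := fun x => ∑ s ∈ S, (∏ i, x i ^ s i) * G s x
  have hQ : Continuous Q := continuous_finsetSum _ fun s _ =>
    (continuous_finsetProd _ fun i _ => by fun_prop).mul (hG s).continuous
  obtain ⟨A₀, hA₀, hdec₀⟩ := exists_norm_localized_le hSne hG hK hgrad hχ₁
    (fun y hy => by simp [hχK y hy]) hφ' 0
  obtain ⟨A, hA, hdec⟩ := exists_norm_localized_le hSne hG hK hgrad hχ₁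
    (fun y hy => by simp [hχK y hy]) hφ' N
  set B := A₀ + A + 1 with hB
  have hBpos : 0 < B := by positivity
  have hχpos : 0 < ∫ y, χ y := χ.integral_pos
  refine ⟨(∫ y, χ y)⁻¹ * (B * C₁), by positivity, fun t ht => ?_⟩
  have ht0 : 0 < t := by linarith
  let F : (Fin n → ℝ) → ℂ := fun x => Complex.exp (Complex.I * t * (Q x : ℝ)) * φ' x
  have hF : Continuous F := by
    have := hφ'.continuous
    fun_prop
  have hFsupp : HasCompactSupport F := HasCompactSupport.intro
    (isCompact_closedBall (0 : Fin n → ℝ) (ρ / 2)) fun x hx => by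
      have : φ' x = 0 := by
        by_contra h
        exact hx (mem_closedBall_zero_iff.2 ((hφsupp x h).le.trans (min_le_left _ _)))
      simp [F, this]
  have hI : oscIntegral f φ t = ∫ x, F x := by
    rw [oscIntegral_eq_integral_pi]
    congr 1
    funext x
    by_cases hx : φ' x = 0
    · change _ * φ' x = _ * φ' x
      rw [hx, mul_zero, mul_zero]
    · have h1 := hball (y := x) (by
        rw [dist_zero_right]; exact (hφsupp x hx).trans_le (min_le_right _ _))
      rw [h1]
  let J : (Fin n → ℝ) → ℂ := fun x =>
    ∫ y, ((χ y * ∏ i, y i : ℝ) : ℂ) * F (x * y)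
  have havg : ((∫ y, χ y : ℝ) : ℂ) * ∫ x, F x = ∫ x, J x :=
    integral_mul_integral_eq hF hFsupp χ.continuous hK hKpos hχK
  have hJ0 : ∀ x, ρ < ‖x‖ → J x = 0 := fun x hx => by
    refine integral_eq_zero_of_ae (Eventually.of_forall fun y => ?_)
    by_cases hy : y ∈ K
    · have : φ' (x * y) = 0 := by
        by_contra h
        have h2 := (hφsupp _ h).trans_le (min_le_left _ _)
        refine absurd hx (not_lt.2 ((pi_norm_le_iff_of_nonneg hρ.le).2 fun i => ?_))
        have h3 := (norm_le_pi_norm _ i).trans h2.le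
        have h4 := hKpos y hy i
        have h5 : 0 ≤ y i := by linarith
        rw [Pi.mul_apply, norm_mul, Real.norm_of_nonneg h5] at h3
        nlinarith [norm_nonneg (x i)]
      simp [F, this]
    · simp [hχK y hy]
  have hcube := hvol t ht (fun x => ‖J x‖ / B) fun x hx hx1 => by
    have hM := monomialSize_pos hSne hx
    by_cases hxρ : ‖x‖ ≤ ρ
    · have h0 := hdec₀ x hx hxρ t ht0
      have h1 := hdec x hx hxρ t ht0
      rw [pow_zero, mul_one] at h0
      refine ⟨(div_le_one hBpos).2 (h0.trans (by linarith)), (div_le_iff₀ hBpos).2 (h1.trans ?_)⟩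
      rw [mul_comm]
      gcongr
      linarith
    · rw [hJ0 x (not_le.1 hxρ), norm_zero, zero_div]
      exact ⟨zero_le_one, by positivity⟩
  have hlog : 0 ≤ Real.log t := Real.log_nonneg (by linarith)
  have hfin := norm_integral_le_of_cube hBpos (by positivity)
    (fun x hx => hJ0 x (hρ1.trans_lt hx)) hcube
  rw [← havg, ← hI, norm_mul, Complex.norm_real, Real.norm_of_nonneg hχpos.le] at hfin
  calc ‖oscIntegral f φ t‖
      ≤ (∫ y, χ y)⁻¹ * (B * (C₁ * t ^ (-(1 / d)) * Real.log t ^ (k - 1))) := by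
        rw [inv_mul_eq_div, le_div_iff₀ hχpos, mul_comm]; exact hfin
    _ = _ := by ring

end

end OscNewton

theorem mainTheorem1 {n : ℕ} (f : EuclideanSpace ℝ (Fin n) → ℝ)
    (hf : OscNewton.RealAnalyticNearZero f) (hnd : OscNewton.IsNondegenerate f)
    (hf0 : f 0 = 0) (hgrad : gradient f 0 = 0)
    (γ : Set (Fin n → ℝ)) (hγ : OscNewton.IsPrincipalFace f γ)
    (k : ℕ) (hk : OscNewton.faceDim γ + k = n) :
    ∃ r : ℝ, 0 < r ∧
      ∀ φ : EuclideanSpace ℝ (Fin n) → ℂ,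
        ContDiff ℝ ((⊤ : ℕ∞) : WithTop ℕ∞) φ →
        tsupport φ ⊆ Metric.ball (0 : EuclideanSpace ℝ (Fin n)) r →
        ((¬ ∃ m : ℤ, 1 / OscNewton.newtonDistance f = (m : ℝ)) →
          ∃ C : ℝ, ∀ t : ℝ, 2 ≤ t →
            ‖OscNewton.oscIntegral f φ t‖ ≤
              C * t ^ (-(1 / OscNewton.newtonDistance f)) * Real.log t ^ (k - 1)) ∧
        ((∃ m : ℤ, 1 / OscNewton.newtonDistance f = (m : ℝ)) →
          ∃ C : ℝ, ∀ t : ℝ, 2 ≤ t →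
            ‖OscNewton.oscIntegral f φ t‖ ≤
              C * t ^ (-(1 / OscNewton.newtonDistance f)) * Real.log t ^ k) := by
  obtain ⟨r, hr, h⟩ := OscNewton.exists_norm_oscIntegral_le hf hnd hf0 hγ hk
  refine ⟨r, hr, fun φ hφ hsupp => ?_⟩
  obtain ⟨C, hC0, hC⟩ := h φ hφ hsupp
  refine ⟨fun _ => ⟨C, hC⟩, fun _ => ?_⟩
  rcases k with _ | k
  · exact ⟨C, hC⟩
  · refine ⟨C * (Real.log 2)⁻¹, fun t ht => (hC t ht).trans ?_⟩
    have hlog2 : 0 < Real.log 2 := Real.log_pos one_lt_two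
    have hlog : Real.log 2 ≤ Real.log t := Real.log_le_log two_pos ht
    have h0 : 0 < Real.log t := hlog2.trans_le hlog
    have ht0 : 0 < t := by linarith
    have h1 : 1 ≤ (Real.log 2)⁻¹ * Real.log t := by
      rw [inv_mul_eq_div]; exact (one_le_div hlog2).2 hlog
    rw [Nat.add_sub_cancel]
    calc C * t ^ (-(1 / OscNewton.newtonDistance f)) * Real.log t ^ k
        ≤ C * t ^ (-(1 / OscNewton.newtonDistance f)) * Real.log t ^ k *
            ((Real.log 2)⁻¹ * Real.log t) := le_mul_of_one_le_right (by positivity) h1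
      _ = _ := by ring
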